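/- **Definitions.** An $r$-graph $\mathcal H$ on a finite vertex set $V$ is a collection of $r$-element subsets of $V$ (its edges); $|\mathcal H|$ is the number of edges. An $r$-graph contains another one if it has a (not necessarily induced) subgraph isomorphic to it. A complete $\ell$-partite $r$-graph has its vertex set partitioned into $\ell$ nonempty parts, and its edges are all $r$-sets of vertices with at most one vertex in each part. For $n\ge \ell$, $T_r(n,\ell)$ is the complete $\ell$-partite $r$-graph on $n$ vertices in which any two part sizes differ by at most one, and $t_r(n,\ell)$ is its number of edges. $\mathcal K_{\ell+1}^{r}$ is the family of all $r$-graphs $F$ with at most $\binom{\ell+1}{2}$ edges such that, for some set $S$ of $\ell+1$ vertices of $F$, every pair $\{x,y\}\subset S$ is covered by an edge of $F$. An $r$-graph $\mathcal H$ is $\mathcal K_{\ell+1}^{r}$-saturated if it contains no member of $\mathcal K_{\ell+1}^{r}$, but for every $r$-set $E\subset V$ that is not an edge, $\mathcal H\cup\{E\}$ contains a member of $\mathcal K_{\ell+1}^{r}$. **Theorem.** (1) For every integer $\ell\ge 3$ there is a constant $C_\ell>0$, depending only on $\ell$, such that the following holds for all integers $r,n$ with $\ell\ge r\ge 3$ and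 $n\ge 10^{20}\ell^{20}$ and all real $\varepsilon\le n^{1/\ell-1}$. Every $\mathcal K_{\ell+1}^{r}$-saturated $r$-graph $\mathcal H$ on $n$ vertices with $$|\mathcal H|\ \ge\ t_r(n,\ell)-\frac{\binom{\ell}{r}\,r\,\varepsilon}{4(\ell-1)\ell^{r-1}}\,n^{r}$$ contains a complete $\ell$-partite $r$-graph on at least $$\left(1-C_\ell\,\varepsilon\, n^{1-1/\ell}-10^{6}\ell^{3}(3r-4)^{3}\varepsilon\right)n$$ vertices. (2) Consequently, let $\ell\ge r\ge 3$ be integers and let $f:\mathbb N\to\mathbb R$ satisfy $f(n)=o(n^{r-1+1/\ell})$. Then there is a function $g:\mathbb N\to\mathbb R$ with $g(n)\to 0$ as $n\to\infty$ such that, for all sufficiently large $n$, every $\mathcal K_{\ell+1}^{r}$-saturated $r$-graph on $n$ vertices with at least $t_r(n,\ell)-f(n)$ edges contains a complete $\ell$-partite $r$-graph on at least $(1-g(n))n$ vertices. -/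

import Mathlib

open Filter Asymptotics

/-- An `r`-uniform hypergraph (`r`-graph) on the vertex set `V`: a finite collection of
`r`-element subsets of `V`. -/
structure RGraph (r : ℕ) (V : Type*) where
  edges : Finset (Finset V)
  uniform : ∀ e ∈ edges, e.card = r

namespace RGraph

variable {r : ℕ} {V W κ : Type*}

/-- `H` contains (a copy of) `F` as a subgraph, not necessarily induced. -/
def Contains (H : RGraph r V) (F : RGraph r W) : Prop :=
  ∃ f : W ↪ V, ∀ e ∈ F.edges, e.map f ∈ H.edges

/-- The `r`-graph obtained from `H` by adding the `r`-set `E` to its edges. -/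
def addEdge [DecidableEq V] (H : RGraph r V) (E : Finset V) (hE : E.card = r) : RGraph r V where
  edges := insert E H.edges
  uniform := by
    intro e he
    rcases Finset.mem_insert.mp he with rfl | he
    · exact hE
    · exact H.uniform e he

/-- `H` is `𝓕`-free: it contains no member of the family `𝓕` as a subgraph. Members of families
have vertex set `Fin m` for some `m`, which represents every finite `r`-graph up to
isomorphism. -/
def IsFree (𝓕 : Set (Σ m : ℕ, RGraph r (Fin m))) (H : RGraph r V) : Prop :=
  ∀ F ∈ 𝓕, ¬ H.Contains F.2

/-- `H` is `𝓕`-saturated: it is `𝓕`-free, and adding any new edge creates a copy of a member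
of `𝓕`. -/
def IsSaturated [DecidableEq V] (𝓕 : Set (Σ m : ℕ, RGraph r (Fin m))) (H : RGraph r V) : Prop :=
  H.IsFree 𝓕 ∧
    ∀ (E : Finset V) (hE : E.card = r), E ∉ H.edges → ∃ F ∈ 𝓕, (H.addEdge E hE).Contains F.2

/-- The family `𝒦ₖʳ`: all `r`-graphs with at most `k.choose 2` edges which have a set `S` of
`k` vertices such that each pair of vertices of `S` is covered by an edge. -/
def coverFamily (r k : ℕ) : Set (Σ m : ℕ, RGraph r (Fin m)) :=
  {F | F.2.edges.card ≤ k.choose 2 ∧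
    ∃ S : Finset (Fin F.1), S.card = k ∧
      ∀ x ∈ S, ∀ y ∈ S, x ≠ y → ∃ e ∈ F.2.edges, x ∈ e ∧ y ∈ e}

/-- The complete multipartite `r`-graph whose parts are the fibres of `c`: its edges are all
`r`-sets of vertices with at most one vertex in each part. -/
def completePartite (r : ℕ) [Fintype V] [DecidableEq V] [DecidableEq κ] (c : V → κ) :
    RGraph r V where
  edges := (Finset.powersetCard r Finset.univ).filter
    fun e => ∀ x ∈ e, ∀ y ∈ e, c x = c y → x = y
  uniform := by
    intro e he
    exact (Finset.mem_powersetCard.mp (Finset.mem_filter.mp he).1).2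

/-- The generalized Turán graph `T_r(n, ℓ)`: the complete `ℓ`-partite `r`-graph on `n` vertices
whose parts, the residue classes modulo `ℓ`, have sizes differing by at most one. -/
def turan (r n ℓ : ℕ) : RGraph r (Fin n) :=
  completePartite r fun i : Fin n => (i : ℕ) % ℓ

/-- The number `t_r(n, ℓ)` of edges of `T_r(n, ℓ)`. -/
def turanNumber (r n ℓ : ℕ) : ℕ := (turan r n ℓ).edges.card

/-- `H` contains as a subgraph a complete `ℓ`-partite `r`-graph on `m` vertices, with `ℓ` nonempty
parts. (Were parts allowed to be empty, a single part would give an edgeless `r`-graph, which is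
contained in every `r`-graph.) -/
def ContainsCompletePartite (H : RGraph r V) (ℓ m : ℕ) : Prop :=
  ∃ c : Fin m → Fin ℓ, Function.Surjective c ∧ H.Contains (completePartite r c)

end RGraph

/-! The edges of a saturated `r`-graph are exactly the `r`-cliques of any maximal `K_{ℓ+1}`-free
graph `G` containing its shadow (`IsSaturated.exists_maximal_cliqueFree`), so the theorem is a
stability statement about `G`. Let `D` be the deficit in `r`-cliques against the Turán number, `δ =
(1 - 1/ℓ)n² - 2e(G)` and `p = n^{1/ℓ}`. The Moon–Moser inequality bounds ratios of consecutive
clique counts, and the Turán number is at most `O(n^{r-2})` below `(ℓ choose r)(n/ℓ)^r`; together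
they give `δ = O(D/n^{r-2} + 1)` (`exists_edgeDefect_le`).

Füredi's argument yields an almost balanced `ℓ`-partition with `O(δ)` missing cross pairs. A set `A`
of `O(δ/n)` vertices misses linearly many neighbours, and outside `A` the classes are independent.
Another `O(δ/p)` vertices miss more than about `p`. Maximality treats the rest: non-adjacent `x`,
`y` in different classes extend a common `(ℓ-1)`-clique `K` to two `ℓ`-cliques, and counting colours
shows that `K` meets `A`. Branching over the vertices of `K` (`exists_small_cover`) confines `x` to
a set of size `O(|A| p^{ℓ-1}) = O(δ/p)`; the choice `p^ℓ = n` balances the last two losses. Deleting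
all these vertices leaves a complete `ℓ`-partite graph (`exists_large_completePartite`).

The additive `1` is harmless: if `A` is empty nothing is lost, and otherwise `n = O(δ)`, which
forces `D/n^{r-2} ≥ 1` for large `n`. The case `D = 0` is the equality case of Zykov's theorem.
Altogether `O(D/n^{r-2+1/ℓ})` vertices are lost (`exists_containsCompletePartite`), and both parts
follow. -/

namespace SimpleGraph

/-! ### Counting cliques relative to a fixed clique -/

variable {V : Type*}

open Classical in
/-- The `k`-cliques of `G` contained in `U`. -/
noncomputable def cliquesIn (G : SimpleGraph V) (U : Finset V) (k : ℕ) : Finset (Finset V) :=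
  (U.powersetCard k).filter fun s => G.IsClique (s : Set V)

open Classical in
/-- The vertices of `Q` adjacent to all vertices of `R`. -/
noncomputable def commonIn (G : SimpleGraph V) (Q R : Finset V) : Finset V :=
  Q.filter fun q => ∀ v ∈ R, G.Adj v q

theorem mem_cliquesIn {G : SimpleGraph V} {U s : Finset V} {k : ℕ} :
    s ∈ G.cliquesIn U k ↔ s ⊆ U ∧ s.card = k ∧ G.IsClique (s : Set V) := by
  simp [cliquesIn, Finset.mem_powersetCard, and_assoc]

theorem mem_commonIn {G : SimpleGraph V} {Q R : Finset V} {q : V} :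
    q ∈ G.commonIn Q R ↔ q ∈ Q ∧ ∀ v ∈ R, G.Adj v q := by
  simp [commonIn]

theorem isClique_union [DecidableEq V] {G : SimpleGraph V} {s t : Finset V}
    (hs : G.IsClique (s : Set V)) (ht : G.IsClique (t : Set V))
    (h : ∀ x ∈ s, ∀ y ∈ t, G.Adj x y) : G.IsClique ((s ∪ t : Finset V) : Set V) := by
  intro x hx y hy hxy
  simp only [Finset.coe_union, Set.mem_union, Finset.mem_coe] at hx hy
  rcases hx with hx | hx <;> rcases hy with hy | hy
  · exact hs hx hy hxy
  · exact h x hx y hy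
  · exact (h y hy x hx).symm
  · exact ht hx hy hxy

/-- A clique splits into its part `R` outside `Q` and its part inside `Q`; since `Q` is a clique,
the latter can be any subset of the common neighbours of `R` in `Q`. -/
theorem card_cliquesIn_eq_sum [DecidableEq V] {G : SimpleGraph V} {Q U : Finset V} (hQU : Q ⊆ U)
    (hQ : G.IsClique (Q : Set V)) (r : ℕ) :
    (G.cliquesIn U r).card =
      ∑ i ∈ Finset.range (r + 1), ∑ R ∈ G.cliquesIn (U \ Q) i,
        (G.commonIn Q R).card.choose (r - i) := by
  rw [Finset.card_eq_sum_card_fiberwise (f := fun s => (s \ Q).card) (t := Finset.range (r + 1))]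
  swap
  · intro s hs
    have hs := mem_cliquesIn.1 hs
    have := Finset.card_le_card (Finset.sdiff_subset : s \ Q ⊆ s)
    simp only [Finset.coe_range, Set.mem_Iio]
    omega
  refine Finset.sum_congr rfl fun i hi => ?_
  rw [Finset.card_eq_sum_card_fiberwise (f := fun s => s \ Q) (t := G.cliquesIn (U \ Q) i)]
  swap
  · intro s hs
    obtain ⟨hs, hi⟩ := Finset.mem_filter.1 hs
    obtain ⟨hsU, hsr, hsc⟩ := mem_cliquesIn.1 hs
    exact mem_cliquesIn.2 ⟨Finset.sdiff_subset_sdiff hsU subset_rfl, hi,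
      hsc.subset (by simp)⟩
  refine Finset.sum_congr rfl fun R hR => ?_
  obtain ⟨hRU, hRi, hRc⟩ := mem_cliquesIn.1 hR
  have hdis : Disjoint R Q :=
    Finset.disjoint_left.2 fun x hx => (Finset.mem_sdiff.1 (hRU hx)).2
  have hi' : i ≤ r := by simpa [Nat.lt_succ_iff] using hi
  rw [← Finset.card_powersetCard]
  refine Finset.card_nbij' (fun s => s ∩ Q) (fun t => t ∪ R) ?_ ?_ ?_ ?_
  · intro s hs
    obtain ⟨hs, hsR⟩ := Finset.mem_filter.1 hs
    obtain ⟨hs, -⟩ := Finset.mem_filter.1 hs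
    obtain ⟨hsU, hsr, hsc⟩ := mem_cliquesIn.1 hs
    subst hsR
    refine Finset.mem_powersetCard.2 ⟨fun q hq => ?_, ?_⟩
    · obtain ⟨hqs, hqQ⟩ := Finset.mem_inter.1 hq
      refine mem_commonIn.2 ⟨hqQ, fun v hv => ?_⟩
      obtain ⟨hvs, hvQ⟩ := Finset.mem_sdiff.1 hv
      exact hsc hvs hqs (by rintro rfl; exact hvQ hqQ)
    · have := Finset.card_sdiff_add_card_inter s Q
      simp only
      omega
  · intro t ht
    obtain ⟨htN, htc⟩ := Finset.mem_powersetCard.1 ht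
    have htQ : t ⊆ Q := fun q hq => (mem_commonIn.1 (htN hq)).1
    have h1 : (t ∪ R) \ Q = R := by
      rw [Finset.union_sdiff_distrib, Finset.sdiff_eq_empty_iff_subset.2 htQ, Finset.empty_union,
        hdis.sdiff_eq_left]
    simp only [Finset.coe_filter, Finset.mem_filter, Set.mem_ofPred_eq]
    refine ⟨⟨mem_cliquesIn.2 ⟨?_, ?_, ?_⟩, by rw [h1, hRi]⟩, h1⟩
    · exact Finset.union_subset (htQ.trans hQU) (hRU.trans Finset.sdiff_subset)
    · rw [Finset.card_union_of_disjoint (hdis.symm.mono_left htQ)]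
      omega
    · exact isClique_union (hQ.subset (by exact_mod_cast htQ)) hRc
        fun x hx y hy => ((mem_commonIn.1 (htN hx)).2 y hy).symm
  · intro s hs
    obtain ⟨hs, hsR⟩ := Finset.mem_filter.1 hs
    simp only [← hsR]
    rw [Finset.union_comm, Finset.sdiff_union_inter]
  · intro t ht
    obtain ⟨htN, htc⟩ := Finset.mem_powersetCard.1 ht
    have htQ : t ⊆ Q := fun q hq => (mem_commonIn.1 (htN hq)).1
    simp only
    rw [Finset.union_inter_distrib_right, Finset.disjoint_iff_inter_eq_empty.1 hdis,
      Finset.union_empty, Finset.inter_eq_left.2 htQ]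

theorem card_commonIn_add_card_le [DecidableEq V] {G : SimpleGraph V} {Q R U : Finset V} {ℓ i : ℕ}
    (hG : G.CliqueFreeOn (U : Set V) (ℓ + 1)) (hQU : Q ⊆ U) (hQ : G.IsClique (Q : Set V))
    (hR : R ∈ G.cliquesIn (U \ Q) i) : (G.commonIn Q R).card + i ≤ ℓ := by
  obtain ⟨hRU, hRi, hRc⟩ := mem_cliquesIn.1 hR
  by_contra! h
  have hsub : G.commonIn Q R ⊆ Q := fun q hq => (mem_commonIn.1 hq).1
  have hdis : Disjoint (G.commonIn Q R) R :=
    Finset.disjoint_left.2 fun x hx hxR => (Finset.mem_sdiff.1 (hRU hxR)).2 (hsub hx)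
  have hc : G.IsClique ((G.commonIn Q R ∪ R : Finset V) : Set V) :=
    isClique_union (hQ.subset (by exact_mod_cast hsub)) hRc
      fun x hx y hy => ((mem_commonIn.1 hx).2 y hy).symm
  have hcard : ℓ + 1 ≤ (G.commonIn Q R ∪ R).card := by
    rw [Finset.card_union_of_disjoint hdis]; omega
  obtain ⟨t, ht, htc⟩ := Finset.exists_subset_card_eq hcard
  refine hG (t := t) ?_ ⟨hc.subset (by exact_mod_cast ht), htc⟩
  exact_mod_cast ht.trans (Finset.union_subset (hsub.trans hQU) (hRU.trans Finset.sdiff_subset))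

/-- The complete `ℓ`-partite graph on `ℕ` whose parts are the residue classes modulo `ℓ`. -/
def residueGraph (ℓ : ℕ) : SimpleGraph ℕ where
  Adj x y := x % ℓ ≠ y % ℓ
  symm := ⟨fun _ _ h => h.symm⟩
  loopless := ⟨fun _ h => h rfl⟩

/-- The number of `r`-cliques in the balanced complete `ℓ`-partite graph on `n` vertices. -/
noncomputable def turanCliques (ℓ r n : ℕ) : ℕ :=
  ((residueGraph ℓ).cliquesIn (Finset.range n) r).card

theorem isClique_residueGraph_iff {ℓ : ℕ} {s : Finset ℕ} :
    (residueGraph ℓ).IsClique (s : Set ℕ) ↔ ∀ x ∈ s, ∀ y ∈ s, x % ℓ = y % ℓ → x = y := by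
  constructor
  · intro h x hx y hy hxy
    by_contra hne
    exact h hx hy hne hxy
  · intro h x hx y hy hne hxy
    exact hne (h x hx y hy hxy)

/-- The last `ℓ` vertices form a clique `Q` meeting every residue class once, so a clique of size
`i` outside `Q` has exactly `ℓ - i` common neighbours in `Q`. This is the equality case of the
recursion behind Zykov's theorem. -/
theorem turanCliques_add (ℓ r n : ℕ) (hℓ : 0 < ℓ) :
    turanCliques ℓ r (n + ℓ) =
      ∑ i ∈ Finset.range (r + 1), turanCliques ℓ i n * (ℓ - i).choose (r - i) := by
  set Q := Finset.Ico n (n + ℓ) with hQdef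
  have hmod : Q.image (· % ℓ) = Finset.range ℓ := Nat.image_Ico_mod n ℓ
  have hinj : Set.InjOn (· % ℓ) (Q : Set ℕ) := by
    rw [← Finset.card_image_iff, hmod]; simp [hQdef]
  have hQ : (residueGraph ℓ).IsClique (Q : Set ℕ) :=
    isClique_residueGraph_iff.2 fun x hx y hy h => hinj hx hy h
  have hQU : Q ⊆ Finset.range (n + ℓ) := by
    intro x hx; simp [hQdef] at hx ⊢; omega
  have hdiff : Finset.range (n + ℓ) \ Q = Finset.range n := by
    ext x; simp [hQdef]; omega
  unfold turanCliques
  rw [card_cliquesIn_eq_sum hQU hQ, hdiff]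
  refine Finset.sum_congr rfl fun i hi => ?_
  rw [← smul_eq_mul, ← Finset.sum_const]
  refine Finset.sum_congr rfl fun R hR => ?_
  obtain ⟨hRU, hRi, hRc⟩ := mem_cliquesIn.1 hR
  congr 1
  have hsub : commonIn (residueGraph ℓ) Q R = Q.filter (fun q => q % ℓ ∉ R.image (· % ℓ)) := by
    ext q
    simp only [mem_commonIn, Finset.mem_filter, Finset.mem_image, not_exists, not_and]
    rfl
  have hcardimg : ((commonIn (residueGraph ℓ) Q R).image (· % ℓ)) =
      Finset.range ℓ \ R.image (· % ℓ) := by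
    rw [hsub, ← hmod]
    ext z
    simp only [Finset.mem_image, Finset.mem_filter, Finset.mem_sdiff]
    constructor
    · rintro ⟨q, ⟨hq, h⟩, rfl⟩; exact ⟨⟨q, hq, rfl⟩, h⟩
    · rintro ⟨⟨q, hq, rfl⟩, h⟩; exact ⟨q, ⟨hq, h⟩, rfl⟩
  rw [← Finset.card_image_of_injOn (f := (· % ℓ)) (hinj.mono ?_), hcardimg,
    Finset.card_sdiff_of_subset, Finset.card_range, Finset.card_image_of_injOn, hRi]
  · intro x hx y hy h
    exact isClique_residueGraph_iff.1 hRc x hx y hy h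
  · intro z hz
    obtain ⟨q, -, rfl⟩ := Finset.mem_image.1 hz
    exact Finset.mem_range.2 (Nat.mod_lt _ hℓ)
  · intro q hq
    exact (mem_commonIn.1 hq).1

theorem mem_completePartite {κ : Type*} {r : ℕ} [Fintype V] [DecidableEq V] [DecidableEq κ]
    {c : V → κ} {e : Finset V} : e ∈ (RGraph.completePartite r c).edges ↔
      e.card = r ∧ ∀ x ∈ e, ∀ y ∈ e, c x = c y → x = y := by
  simp [RGraph.completePartite]

theorem turanNumber_eq_turanCliques (r n ℓ : ℕ) :
    RGraph.turanNumber r n ℓ = turanCliques ℓ r n := by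
  unfold RGraph.turanNumber turanCliques RGraph.turan
  refine Finset.card_bij (fun s _ => s.map Fin.valEmbedding) ?_ ?_ ?_
  · intro s hs
    obtain ⟨hs, h⟩ := mem_completePartite.1 hs
    refine mem_cliquesIn.2 ⟨?_, by simpa using hs, ?_⟩
    · intro x hx
      obtain ⟨y, -, rfl⟩ := Finset.mem_map.1 hx
      exact Finset.mem_range.2 y.2
    · rw [isClique_residueGraph_iff]
      intro x hx y hy hxy
      obtain ⟨x', hx', rfl⟩ := Finset.mem_map.1 hx
      obtain ⟨y', hy', rfl⟩ := Finset.mem_map.1 hy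
      rw [h x' hx' y' hy' hxy]
  · intro s _ t _ h
    exact Finset.map_injective _ h
  · intro s hs
    obtain ⟨hsU, hsr, hsc⟩ := mem_cliquesIn.1 hs
    have key : (Finset.univ.filter fun i : Fin n => (i : ℕ) ∈ s).map Fin.valEmbedding = s := by
      ext x
      simp only [Finset.mem_map, Finset.mem_filter, Finset.mem_univ, true_and,
        Fin.valEmbedding_apply]
      exact ⟨by rintro ⟨y, hy, rfl⟩; exact hy,
        fun hx => ⟨⟨x, Finset.mem_range.1 (hsU hx)⟩, hx, rfl⟩⟩
    refine ⟨_, mem_completePartite.2 ⟨?_, ?_⟩, key⟩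
    · rw [← hsr]
      conv_rhs => rw [← key]
      simp
    · intro x hx y hy hxy
      exact Fin.ext (isClique_residueGraph_iff.1 hsc x (Finset.mem_filter.1 hx).2 y
        (Finset.mem_filter.1 hy).2 hxy)

end SimpleGraph

/-! ### Zykov's theorem and its equality case -/

namespace SimpleGraph

variable {V : Type*}

theorem cliquesIn_mono_graph {G H : SimpleGraph V} (h : G ≤ H) (U : Finset V) (k : ℕ) :
    G.cliquesIn U k ⊆ H.cliquesIn U k := fun s hs => by
  obtain ⟨h1, h2, h3⟩ := mem_cliquesIn.1 hs
  exact mem_cliquesIn.2 ⟨h1, h2, h3.mono h⟩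

theorem turanCliques_of_le {ℓ n : ℕ} (r : ℕ) (h : n ≤ ℓ) : turanCliques ℓ r n = n.choose r := by
  have : (residueGraph ℓ).cliquesIn (Finset.range n) r = (Finset.range n).powersetCard r := by
    ext s
    rw [mem_cliquesIn, Finset.mem_powersetCard, isClique_residueGraph_iff]
    refine ⟨fun hs => ⟨hs.1, hs.2.1⟩, fun hs => ⟨hs.1, hs.2, fun x hx y hy hxy => ?_⟩⟩
    have hx := Finset.mem_range.1 (hs.1 hx)
    have hy := Finset.mem_range.1 (hs.1 hy)
    rwa [Nat.mod_eq_of_lt (by omega), Nat.mod_eq_of_lt (by omega)] at hxy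
  rw [turanCliques, this, Finset.card_powersetCard, Finset.card_range]

theorem card_cliquesIn_le_choose (G : SimpleGraph V) (U : Finset V) (r : ℕ) :
    (G.cliquesIn U r).card ≤ U.card.choose r := by
  rw [← Finset.card_powersetCard]
  exact Finset.card_le_card fun s hs => by
    obtain ⟨h1, h2, -⟩ := mem_cliquesIn.1 hs
    exact Finset.mem_powersetCard.2 ⟨h1, h2⟩

/-- Adding a missing edge `xy` creates an `(ℓ+1)`-clique, and deleting `x` from it leaves a clique
of `G`. -/
theorem exists_clique_of_maximal_cliqueFreeOn [DecidableEq V] {G : SimpleGraph V} {U : Finset V}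
    {ℓ : ℕ} (hG : Maximal (fun H : SimpleGraph V => H.CliqueFreeOn (U : Set V) (ℓ + 1)) G)
    (hU : ℓ < U.card) : ∃ Q ⊆ U, Q.card = ℓ ∧ G.IsClique (Q : Set V) := by
  have hnot : ¬ G.IsClique (U : Set V) := fun hc => by
    obtain ⟨t, ht, htc⟩ := Finset.exists_subset_card_eq hU
    exact hG.1 (t := t) (by exact_mod_cast ht) ⟨hc.subset (by exact_mod_cast ht), htc⟩
  obtain ⟨x, hx, y, hy, hxy, hadj⟩ : ∃ x ∈ U, ∃ y ∈ U, x ≠ y ∧ ¬ G.Adj x y := by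
    by_contra! h
    exact hnot fun x hx y hy hxy => h x hx y hy hxy
  have := hG.not_prop_of_gt (G.lt_sup_edge _ _ hxy hadj)
  simp only [CliqueFreeOn, not_forall, not_not] at this
  obtain ⟨t, htU, ht⟩ := this
  have hc : G.IsClique ((t.erase x : Finset V) : Set V) := by
    rw [Finset.coe_erase]; exact ht.1.sdiff_of_sup_edge
  have hcard : ℓ ≤ (t.erase x).card := by
    have := Finset.pred_card_le_card_erase (s := t) (a := x)
    have := ht.2
    omega
  obtain ⟨Q, hQ, hQc⟩ := Finset.exists_subset_card_eq hcard
  refine ⟨Q, ?_, hQc, hc.subset (by exact_mod_cast hQ)⟩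
  exact (hQ.trans (Finset.erase_subset _ _)).trans (by exact_mod_cast htU)

/-- Zykov's theorem: a `K_{ℓ+1}`-free graph has at most as many `r`-cliques as the Turán graph. -/
theorem card_cliquesIn_le_turanCliques [Finite V] [DecidableEq V] {ℓ : ℕ} (hℓ : 0 < ℓ) (n : ℕ) :
    ∀ (G : SimpleGraph V) (U : Finset V), U.card = n → G.CliqueFreeOn (U : Set V) (ℓ + 1) →
      ∀ r, (G.cliquesIn U r).card ≤ turanCliques ℓ r n := by
  induction n using Nat.strong_induction_on with
  | _ n ih =>
  intro G U hUn hG r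
  rcases le_or_gt n ℓ with hn | hn
  · rw [turanCliques_of_le r hn, ← hUn]
    exact card_cliquesIn_le_choose G U r
  obtain ⟨G', hGG', hG'⟩ := Finite.exists_le_maximal
    (p := fun H : SimpleGraph V => H.CliqueFreeOn (U : Set V) (ℓ + 1)) hG
  obtain ⟨Q, hQU, hQc, hQ⟩ := exists_clique_of_maximal_cliqueFreeOn hG' (hUn ▸ hn)
  refine (Finset.card_le_card (cliquesIn_mono_graph hGG' U r)).trans ?_
  have hn' : n = (n - ℓ) + ℓ := by omega
  rw [card_cliquesIn_eq_sum hQU hQ, hn', turanCliques_add _ _ _ hℓ]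
  refine Finset.sum_le_sum fun i hi => ?_
  calc ∑ R ∈ G'.cliquesIn (U \ Q) i, (G'.commonIn Q R).card.choose (r - i)
      ≤ ∑ R ∈ G'.cliquesIn (U \ Q) i, (ℓ - i).choose (r - i) := by
        refine Finset.sum_le_sum fun R hR => Nat.choose_le_choose _ ?_
        have := card_commonIn_add_card_le hG'.1 hQU hQ hR
        omega
    _ = (G'.cliquesIn (U \ Q) i).card * (ℓ - i).choose (r - i) := by
        rw [Finset.sum_const, smul_eq_mul]
    _ ≤ _ := by
        refine Nat.mul_le_mul_right _ (ih (n - ℓ) (by omega) G' (U \ Q) ?_ ?_ i)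
        · rw [Finset.card_sdiff_of_subset hQU, hUn, hQc]
        · exact CliqueFreeOn.subset _ (Finset.coe_subset.2 Finset.sdiff_subset) hG'.1

theorem exists_isNClique_of_maximal [Fintype V] [DecidableEq V] {G : SimpleGraph V} {ℓ : ℕ}
    (hG : Maximal (fun H : SimpleGraph V => H.CliqueFree (ℓ + 1)) G) (hV : ℓ < Fintype.card V) :
    ∃ Q : Finset V, G.IsNClique ℓ Q := by
  have : Maximal (fun H : SimpleGraph V => H.CliqueFreeOn ((Finset.univ : Finset V) : Set V)
      (ℓ + 1)) G := by
    simpa only [Finset.coe_univ, cliqueFreeOn_univ] using hG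
  obtain ⟨Q, -, hQc, hQ⟩ := exists_clique_of_maximal_cliqueFreeOn this hV
  exact ⟨Q, hQ, hQc⟩

/-- Equality in Zykov's theorem makes every term of the recursion tight, in particular `i = 1`. A
vertex with at most `ℓ - 2` neighbours in `Q` would lose there, because `r ≥ 2` makes `(ℓ-2).choose
(r-1)` strictly smaller than `(ℓ-1).choose (r-1)`. -/
theorem exists_mem_commonIn_of_turanCliques_le [Fintype V] [DecidableEq V] {G : SimpleGraph V}
    {ℓ r : ℕ} (hr : 2 ≤ r) (hrℓ : r ≤ ℓ) (hG : G.CliqueFree (ℓ + 1)) {Q : Finset V}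
    (hQ : G.IsNClique ℓ Q)
    (h : turanCliques ℓ r (Fintype.card V) ≤ (G.cliquesIn Finset.univ r).card) {v : V}
    (hv : v ∉ Q) : (G.commonIn Q {v}).card = ℓ - 1 := by
  have hQU : Q ⊆ Finset.univ := Finset.subset_univ _
  have hℓ : 0 < ℓ := by omega
  have hcard : (Finset.univ \ Q).card = Fintype.card V - ℓ := by
    rw [Finset.card_sdiff_of_subset hQU, hQ.2, Finset.card_univ]
  have hV : Fintype.card V = (Fintype.card V - ℓ) + ℓ := by
    have := Finset.card_le_univ Q
    rw [hQ.2] at this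
    omega
  rw [card_cliquesIn_eq_sum hQU hQ.1, hV, turanCliques_add _ _ _ hℓ] at h
  by_contra hne
  have hmem : ∀ w ∉ Q, {w} ∈ G.cliquesIn (Finset.univ \ Q) 1 := fun w hw =>
    mem_cliquesIn.2 ⟨by simpa using hw, by simp, by simp⟩
  have hle : ∀ i, ∀ R ∈ G.cliquesIn (Finset.univ \ Q) i,
      (G.commonIn Q R).card.choose (r - i) ≤ (ℓ - i).choose (r - i) := fun i R hR => by
    refine Nat.choose_le_choose _ ?_
    have := card_commonIn_add_card_le hG.cliqueFreeOn hQU hQ.1 hR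
    omega
  have hlt : (G.commonIn Q {v}).card.choose (r - 1) < (ℓ - 1).choose (r - 1) := by
    have h1 := card_commonIn_add_card_le hG.cliqueFreeOn hQU hQ.1 (hmem v hv)
    have h2 : (G.commonIn Q {v}).card ≤ ℓ - 2 := by omega
    refine (Nat.choose_le_choose _ h2).trans_lt ?_
    obtain ⟨a, rfl⟩ : ∃ a, ℓ = a + 2 := ⟨ℓ - 2, by omega⟩
    obtain ⟨b, rfl⟩ : ∃ b, r = b + 2 := ⟨r - 2, by omega⟩
    have : 0 < a.choose b := Nat.choose_pos (by omega)
    simp only [Nat.add_sub_cancel, show a + 2 - 1 = a + 1 by omega,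
      show b + 2 - 1 = b + 1 by omega, Nat.choose_succ_succ' a b]
    omega
  refine absurd h (not_le.2 (Finset.sum_lt_sum (fun i hi => ?_) ⟨1, ?_, ?_⟩))
  · refine (Finset.sum_le_sum (hle i)).trans ?_
    rw [Finset.sum_const, smul_eq_mul]
    exact Nat.mul_le_mul_right _
      (card_cliquesIn_le_turanCliques hℓ _ G _ hcard hG.cliqueFreeOn i)
  · simp; omega
  · refine (Finset.sum_lt_sum (hle 1) ⟨{v}, hmem v hv, hlt⟩).trans_le ?_
    rw [Finset.sum_const, smul_eq_mul]
    exact Nat.mul_le_mul_right _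
      (card_cliquesIn_le_turanCliques hℓ _ G _ hcard hG.cliqueFreeOn 1)

/-- A properly `ℓ`-coloured maximal `K_{ℓ+1}`-free graph is complete multipartite. -/
theorem adj_of_maximal_of_coloring [DecidableEq V] {G : SimpleGraph V} {ℓ : ℕ}
    (hG : Maximal (fun H : SimpleGraph V => H.CliqueFree (ℓ + 1)) G) {c : V → Fin ℓ}
    (hc : ∀ x y, G.Adj x y → c x ≠ c y) {x y : V} (hxy : c x ≠ c y) : G.Adj x y := by
  by_contra hadj
  have hne : x ≠ y := fun h => hxy (h ▸ rfl)
  refine hG.not_prop_of_gt (G.lt_sup_edge _ _ hne hadj) ?_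
  have hcol : (G ⊔ edge x y).Colorable ℓ := by
    refine ⟨Coloring.mk c ?_⟩
    intro a b hab
    rcases hab with hab | hab
    · exact hc a b hab
    · rw [edge_adj] at hab
      rcases hab.1 with ⟨rfl, rfl⟩ | ⟨rfl, rfl⟩
      · exact hxy
      · exact hxy.symm
  exact hcol.cliqueFree (Nat.lt_succ_self ℓ)

/-- A maximal `K_{ℓ+1}`-free graph with as many `r`-cliques as the Turán graph is complete
`ℓ`-partite. -/
theorem exists_completePartition_of_turanCliques_le [Fintype V] [DecidableEq V]
    {G : SimpleGraph V} {ℓ r : ℕ} (hr : 2 ≤ r) (hrℓ : r ≤ ℓ)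
    (hG : Maximal (fun H : SimpleGraph V => H.CliqueFree (ℓ + 1)) G) (hV : ℓ < Fintype.card V)
    (h : turanCliques ℓ r (Fintype.card V) ≤ (G.cliquesIn Finset.univ r).card) :
    ∃ c : V → Fin ℓ, Function.Surjective c ∧ ∀ x y, c x ≠ c y → G.Adj x y := by
  obtain ⟨Q, hQ⟩ := exists_isNClique_of_maximal hG hV
  have hex : ∀ v, ∃ q ∈ Q, ∀ p ∈ Q, ¬ G.Adj v p ↔ p = q := by
    intro v
    by_cases hv : v ∈ Q
    · refine ⟨v, hv, fun p hp => ⟨fun hnot => ?_, ?_⟩⟩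
      · by_contra hne
        exact hnot (hQ.1 hv hp (Ne.symm hne))
      · rintro rfl; exact G.loopless.irrefl p
    · have hcard := exists_mem_commonIn_of_turanCliques_le hr hrℓ hG.1 hQ h hv
      have hsub : G.commonIn Q {v} ⊆ Q := fun q hq => (mem_commonIn.1 hq).1
      have h1 : (Q \ G.commonIn Q {v}).card = 1 := by
        rw [Finset.card_sdiff_of_subset hsub, hQ.2, hcard]; omega
      obtain ⟨q, hq⟩ := Finset.card_eq_one.1 h1
      have hmem : ∀ p, p ∈ Q \ G.commonIn Q {v} ↔ p = q := fun p => by rw [hq]; simp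
      refine ⟨q, (Finset.mem_sdiff.1 ((hmem q).2 rfl)).1, fun p hp => ?_⟩
      rw [← hmem p, Finset.mem_sdiff, mem_commonIn]
      simp [hp]
  choose f hfQ hf using hex
  let e : Q ≃ Fin ℓ := Finset.equivFinOfCardEq hQ.2
  have hfq : ∀ q ∈ Q, f q = q := fun q hq => ((hf q q hq).1 (G.loopless.irrefl q)).symm
  -- Adjacent vertices with the same non-neighbour `q` in `Q` would both extend `Q` minus `q`,
  -- giving an `(ℓ+1)`-clique.
  have hproper : ∀ x y, G.Adj x y → f x ≠ f y := by
    intro x y hxy hfxy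
    have hadjx : ∀ p ∈ Q, p ≠ f x → G.Adj x p := fun p hp hne => by
      by_contra hn
      exact hne ((hf x p hp).1 hn)
    have hadjy : ∀ p ∈ Q, p ≠ f x → G.Adj y p := fun p hp hne => by
      by_contra hn
      exact hne (hfxy ▸ (hf y p hp).1 hn)
    have h1 : G.IsNClique (ℓ - 1) (Q.erase (f x)) :=
      ⟨hQ.1.subset (by simp), by rw [Finset.card_erase_of_mem (hfQ x), hQ.2]⟩
    have h2 := h1.insert (a := y) fun b hb =>
      hadjy b (Finset.mem_erase.1 hb).2 (Finset.mem_erase.1 hb).1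
    have h3 := h2.insert (a := x) fun b hb => by
      rcases Finset.mem_insert.1 hb with rfl | hb
      · exact hxy
      · exact hadjx b (Finset.mem_erase.1 hb).2 (Finset.mem_erase.1 hb).1
    rw [show ℓ - 1 + 1 + 1 = ℓ + 1 by omega] at h3
    exact h3.not_cliqueFree hG.1
  refine ⟨fun v => e ⟨f v, hfQ v⟩, fun i => ⟨(e.symm i : Q), ?_⟩, fun x y hxy => ?_⟩
  · have := hfq (e.symm i : Q) (e.symm i).2
    simp [this]
  · refine adj_of_maximal_of_coloring hG (c := fun v => e ⟨f v, hfQ v⟩) (fun a b hab => ?_) hxy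
    intro heq
    exact hproper a b hab (by simpa using heq)

end SimpleGraph

/-! ### The Moon–Moser inequality and ratios of clique counts -/

namespace SimpleGraph

variable {V : Type*}

section MoonMoser

variable [Fintype V] [DecidableEq V]

theorem sum_cliquesIn_commonIn (G : SimpleGraph V) (s : ℕ) (f : Finset V → V → ℕ) :
    ∑ C ∈ G.cliquesIn Finset.univ s, ∑ v ∈ G.commonIn Finset.univ C, f C v =
      ∑ A ∈ G.cliquesIn Finset.univ (s + 1), ∑ v ∈ A, f (A.erase v) v := by
  rw [Finset.sum_sigma', Finset.sum_sigma']
  have hnot : ∀ {C : Finset V} {v : V}, v ∈ G.commonIn Finset.univ C → v ∉ C := fun hv hvC =>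
    G.loopless.irrefl _ ((mem_commonIn.1 hv).2 _ hvC)
  refine Finset.sum_nbij' (fun p => ⟨insert p.2 p.1, p.2⟩) (fun p => ⟨p.1.erase p.2, p.2⟩)
    ?_ ?_ ?_ ?_ ?_
  · rintro ⟨C, v⟩ h
    obtain ⟨hC, hv⟩ := Finset.mem_sigma.1 h
    obtain ⟨-, hCs, hCc⟩ := mem_cliquesIn.1 hC
    refine Finset.mem_sigma.2 ⟨mem_cliquesIn.2 ⟨Finset.subset_univ _, ?_, ?_⟩, by simp⟩
    · simp only
      rw [Finset.card_insert_of_notMem (hnot hv), hCs]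
    · simp only [Finset.coe_insert]
      exact hCc.insert fun b hb _ => ((mem_commonIn.1 hv).2 b hb).symm
  · rintro ⟨A, v⟩ h
    obtain ⟨hA, hv⟩ := Finset.mem_sigma.1 h
    obtain ⟨-, hAs, hAc⟩ := mem_cliquesIn.1 hA
    simp only at hv
    refine Finset.mem_sigma.2 ⟨mem_cliquesIn.2 ⟨Finset.subset_univ _, ?_, ?_⟩, ?_⟩
    · simp only
      rw [Finset.card_erase_of_mem hv, hAs, Nat.add_sub_cancel]
    · exact hAc.subset (by simp)
    · refine mem_commonIn.2 ⟨Finset.mem_univ _, fun w hw => ?_⟩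
      obtain ⟨hwv, hw⟩ := Finset.mem_erase.1 hw
      exact hAc hw hv hwv
  · rintro ⟨C, v⟩ h
    obtain ⟨hC, hv⟩ := Finset.mem_sigma.1 h
    simp [Finset.erase_insert (hnot hv)]
  · rintro ⟨A, v⟩ h
    obtain ⟨hA, hv⟩ := Finset.mem_sigma.1 h
    simp only at hv
    simp [Finset.insert_erase hv]
  · rintro ⟨C, v⟩ h
    obtain ⟨hC, hv⟩ := Finset.mem_sigma.1 h
    simp [Finset.erase_insert (hnot hv)]

theorem sum_card_commonIn (G : SimpleGraph V) (s : ℕ) :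
    ∑ C ∈ G.cliquesIn Finset.univ s, (G.commonIn Finset.univ C).card =
      (s + 1) * (G.cliquesIn Finset.univ (s + 1)).card := by
  have := sum_cliquesIn_commonIn G s fun _ _ => 1
  simp only [Finset.sum_const, smul_eq_mul, mul_one] at this
  rw [this, Finset.sum_congr rfl fun A hA => (mem_cliquesIn.1 hA).2.1, Finset.sum_const,
    smul_eq_mul, mul_comm]

/-- A vertex with a non-neighbour `u` in `A` can be a common neighbour of `A.erase v` only for `v =
u`, so it is counted at most once; a common neighbour of `A` is counted `s + 1` times. -/
theorem sum_card_commonIn_erase_le {G : SimpleGraph V} {s : ℕ} {A : Finset V}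
    (hA : A ∈ G.cliquesIn Finset.univ (s + 1)) :
    ∑ v ∈ A, (G.commonIn Finset.univ (A.erase v)).card ≤
      s * (G.commonIn Finset.univ A).card + Fintype.card V := by
  classical
  obtain ⟨-, hAs, hAc⟩ := mem_cliquesIn.1 hA
  have h1 : ∑ v ∈ A, (G.commonIn Finset.univ (A.erase v)).card =
      ∑ w : V, (A.filter fun v => w ∈ G.commonIn Finset.univ (A.erase v)).card := by
    simpa [Finset.bipartiteAbove, Finset.bipartiteBelow] using
      Finset.sum_card_bipartiteAbove_eq_sum_card_bipartiteBelow (s := A) (t := Finset.univ)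
        (fun v w => w ∈ G.commonIn Finset.univ (A.erase v))
  have h2 : s * (G.commonIn Finset.univ A).card + Fintype.card V =
      ∑ w : V, ((if w ∈ G.commonIn Finset.univ A then s else 0) + 1) := by
    rw [Finset.sum_add_distrib, Finset.sum_ite_mem]
    simp [mul_comm]
  rw [h1, h2]
  refine Finset.sum_le_sum fun w _ => ?_
  split_ifs with hw
  · exact (Finset.card_filter_le _ _).trans hAs.le
  · obtain ⟨u, huA, hu⟩ : ∃ u ∈ A, ¬ G.Adj u w := by
      by_contra! h
      exact hw (mem_commonIn.2 ⟨Finset.mem_univ _, h⟩)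
    rw [zero_add, ← Finset.card_singleton u]
    refine Finset.card_le_card fun v hv => ?_
    obtain ⟨hvA, hv⟩ := Finset.mem_filter.1 hv
    rw [Finset.mem_singleton]
    by_contra hne
    exact hu ((mem_commonIn.1 hv).2 u (Finset.mem_erase.2 ⟨Ne.symm hne, huA⟩))

/-- The Moon–Moser inequality. -/
theorem moon_moser (G : SimpleGraph V) (s : ℕ) :
    (s + 1) ^ 2 * (G.cliquesIn Finset.univ (s + 1)).card ^ 2 ≤
      (G.cliquesIn Finset.univ s).card *
        (s * (s + 2) * (G.cliquesIn Finset.univ (s + 2)).card +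
          Fintype.card V * (G.cliquesIn Finset.univ (s + 1)).card) := by
  rw [← mul_pow, ← sum_card_commonIn]
  refine sq_sum_le_card_mul_sum_sq.trans (Nat.mul_le_mul_left _ ?_)
  have h := sum_cliquesIn_commonIn G s fun C _ => (G.commonIn Finset.univ C).card
  simp only [Finset.sum_const, smul_eq_mul, ← sq] at h
  rw [h]
  refine (Finset.sum_le_sum fun A hA => sum_card_commonIn_erase_le hA).trans ?_
  rw [Finset.sum_add_distrib, ← Finset.mul_sum, sum_card_commonIn, Finset.sum_const, smul_eq_mul]
  refine le_of_eq ?_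
  ring

/-- Downward induction from `s = ℓ`, where there are no `(ℓ+1)`-cliques: Moon–Moser turns a bound on
one ratio of consecutive clique counts into the bound on the preceding one. -/
theorem mul_card_cliquesIn_succ_le {G : SimpleGraph V} {ℓ : ℕ} (hG : G.CliqueFree (ℓ + 1))
    {s : ℕ} (hs : s ≤ ℓ) :
    ℓ * (s + 1) * (G.cliquesIn Finset.univ (s + 1)).card ≤
      (ℓ - s) * Fintype.card V * (G.cliquesIn Finset.univ s).card := by
  induction hs using Nat.decreasingInduction with
  | self =>
    have : (G.cliquesIn Finset.univ (ℓ + 1)) = ∅ := by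
      refine Finset.eq_empty_of_forall_notMem fun s hs => ?_
      obtain ⟨-, h2, h3⟩ := mem_cliquesIn.1 hs
      exact hG s ⟨h3, h2⟩
    simp [this]
  | of_succ s hs ih =>
    have hmm := moon_moser G s
    obtain ⟨a, rfl⟩ : ∃ a, ℓ = s + 1 + a := ⟨ℓ - (s + 1), by omega⟩
    rw [show s + 1 + a - s = a + 1 by omega]
    rw [show s + 1 + a - (s + 1) = a by omega] at ih
    set k0 := (G.cliquesIn Finset.univ s).card
    set k1 := (G.cliquesIn Finset.univ (s + 1)).card
    set k2 := (G.cliquesIn Finset.univ (s + 2)).card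
    set n := Fintype.card V
    rcases Nat.eq_zero_or_pos k1 with h0 | hpos
    · rw [h0]; simp
    refine Nat.le_of_mul_le_mul_left (c := (s + 1) * k1) ?_ (by positivity)
    calc (s + 1) * k1 * ((s + 1 + a) * (s + 1) * k1)
        = (s + 1 + a) * ((s + 1) ^ 2 * k1 ^ 2) := by ring
      _ ≤ (s + 1 + a) * (k0 * (s * (s + 2) * k2 + n * k1)) := Nat.mul_le_mul_left _ hmm
      _ = k0 * (s * ((s + 1 + a) * (s + 1 + 1) * k2) + (s + 1 + a) * n * k1) := by ring
      _ ≤ k0 * (s * (a * n * k1) + (s + 1 + a) * n * k1) := by gcongr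
      _ = (s + 1) * k1 * ((a + 1) * n * k0) := by ring

/-- The ratio bounds multiplied from `2` up to `j + 2`; a deficit in large cliques thereby becomes
controlling for the number of edges. -/
theorem card_cliquesIn_mul_le {G : SimpleGraph V} {ℓ : ℕ} (hG : G.CliqueFree (ℓ + 1)) (j : ℕ)
    (hj : j + 2 ≤ ℓ) :
    ((G.cliquesIn Finset.univ (j + 2)).card : ℝ) * ℓ.choose 2 ≤
      (G.cliquesIn Finset.univ 2).card * (ℓ.choose (j + 2) * (Fintype.card V / ℓ : ℝ) ^ j) := by
  induction j with
  | zero => simp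
  | succ j ih =>
    have ih := ih (by omega)
    have h1 : (ℓ : ℝ) * (j + 3) * (G.cliquesIn Finset.univ (j + 3)).card ≤
        (ℓ - (j + 2)) * Fintype.card V * (G.cliquesIn Finset.univ (j + 2)).card := by
      have := mul_card_cliquesIn_succ_le hG (s := j + 2) (by omega)
      have h : ((ℓ - (j + 2) : ℕ) : ℝ) = ℓ - (j + 2) := by
        rw [Nat.cast_sub (by omega)]; push_cast; ring
      rw [← h]
      exact_mod_cast this
    have h2 : (ℓ.choose (j + 3) : ℝ) * (j + 3) = ℓ.choose (j + 2) * (ℓ - (j + 2)) := by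
      have := Nat.choose_succ_right_eq ℓ (j + 2)
      have h : ((ℓ - (j + 2) : ℕ) : ℝ) = ℓ - (j + 2) := by
        rw [Nat.cast_sub (by omega)]; push_cast; ring
      rw [← h]
      exact_mod_cast this
    have hℓ : (0 : ℝ) < ℓ := by exact_mod_cast (by omega : 0 < ℓ)
    have hsub : (0 : ℝ) ≤ ℓ - (j + 2) := by
      have : ((j + 2 : ℕ) : ℝ) ≤ ℓ := by exact_mod_cast (by omega : j + 2 ≤ ℓ)
      push_cast at this
      linarith
    have h3 : ((j : ℝ) + 3) * (G.cliquesIn Finset.univ (j + 3)).card ≤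
        (ℓ - (j + 2)) * (Fintype.card V / ℓ) * (G.cliquesIn Finset.univ (j + 2)).card := by
      have : ((j : ℝ) + 3) * (G.cliquesIn Finset.univ (j + 3)).card =
          (ℓ * (j + 3) * (G.cliquesIn Finset.univ (j + 3)).card) / ℓ := by field_simp
      rw [this, div_le_iff₀ hℓ]
      refine h1.trans_eq ?_
      field_simp
    refine le_of_mul_le_mul_left (a := (j : ℝ) + 3) ?_ (by positivity)
    calc ((j : ℝ) + 3) * ((G.cliquesIn Finset.univ (j + 3)).card * ℓ.choose 2)
        = ((j : ℝ) + 3) * (G.cliquesIn Finset.univ (j + 3)).card * ℓ.choose 2 := by ring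
      _ ≤ (ℓ - (j + 2)) * (Fintype.card V / ℓ) * (G.cliquesIn Finset.univ (j + 2)).card *
          ℓ.choose 2 := by gcongr
      _ = (ℓ - (j + 2)) * (Fintype.card V / ℓ) * ((G.cliquesIn Finset.univ (j + 2)).card *
          ℓ.choose 2) := by ring
      _ ≤ (ℓ - (j + 2)) * (Fintype.card V / ℓ) * ((G.cliquesIn Finset.univ 2).card *
          (ℓ.choose (j + 2) * (Fintype.card V / ℓ : ℝ) ^ j)) := by gcongr
      _ = (G.cliquesIn Finset.univ 2).card * ((ℓ.choose (j + 2) * (ℓ - (j + 2))) *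
          (Fintype.card V / ℓ : ℝ) ^ (j + 1)) := by ring
      _ = _ := by rw [← h2]; ring

end MoonMoser

/-! ### Turán numbers against their continuous approximation -/

section TuranNumber

/-- With `x = n / ℓ` this is the recursion of `turanCliques_add` for the continuous value, so the
defect between the two satisfies a recursion of its own. -/
theorem choose_mul_add_one_pow (ℓ r : ℕ) (x : ℝ) :
    (ℓ.choose r : ℝ) * (x + 1) ^ r =
      ∑ i ∈ Finset.range (r + 1), (ℓ.choose i * x ^ i) * (ℓ - i).choose (r - i) := by
  rw [add_pow, Finset.mul_sum]
  refine Finset.sum_congr rfl fun i hi => ?_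
  have hi : i ≤ r := by simpa [Nat.lt_succ_iff] using hi
  rcases le_or_gt r ℓ with hr | hr
  · have := Nat.choose_mul (n := ℓ) hi
    have : (ℓ.choose r : ℝ) * r.choose i = ℓ.choose i * (ℓ - i).choose (r - i) := by
      exact_mod_cast this
    rw [one_pow, mul_one]
    linear_combination x ^ i * this
  · rw [Nat.choose_eq_zero_of_lt hr]
    rcases le_or_gt i ℓ with hiℓ | hiℓ
    · rw [Nat.choose_eq_zero_of_lt (show ℓ - i < r - i by omega)]; simp
    · rw [Nat.choose_eq_zero_of_lt hiℓ]; simp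

theorem turanDefect_add (ℓ r n : ℕ) (hℓ : 0 < ℓ) :
    (ℓ.choose r : ℝ) * ((n + ℓ : ℕ) / ℓ : ℝ) ^ r - turanCliques ℓ r (n + ℓ) =
      ((ℓ.choose r : ℝ) * (n / ℓ : ℝ) ^ r - turanCliques ℓ r n) +
      ∑ i ∈ Finset.range r, ((ℓ.choose i : ℝ) * (n / ℓ : ℝ) ^ i - turanCliques ℓ i n) *
        (ℓ - i).choose (r - i) := by
  have hℓ' : (ℓ : ℝ) ≠ 0 := by exact_mod_cast hℓ.ne'
  have hx : ((n + ℓ : ℕ) / ℓ : ℝ) = n / ℓ + 1 := by push_cast; field_simp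
  rw [hx, choose_mul_add_one_pow, turanCliques_add _ _ _ hℓ]
  push_cast
  rw [← Finset.sum_sub_distrib, Finset.sum_range_succ]
  simp only [sub_mul, Nat.sub_self, Nat.choose_zero_right, Nat.cast_one, mul_one]
  ring

theorem turanDefect_le_one_le (ℓ n : ℕ) (hℓ : 0 < ℓ) {i : ℕ} (hi : i < 2) :
    (ℓ.choose i : ℝ) * (n / ℓ : ℝ) ^ i - turanCliques ℓ i n ≤ 0 := by
  have hℓ' : (ℓ : ℝ) ≠ 0 := by exact_mod_cast hℓ.ne'
  induction n using Nat.strong_induction_on generalizing i with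
  | _ n ih =>
    rcases le_or_gt ℓ n with h | h
    · obtain ⟨m, rfl⟩ : ∃ m, n = m + ℓ := ⟨n - ℓ, by omega⟩
      rw [turanDefect_add _ _ _ hℓ]
      have h1 := ih m (by omega) hi
      have h2 : ∑ j ∈ Finset.range i, ((ℓ.choose j : ℝ) * (m / ℓ : ℝ) ^ j - turanCliques ℓ j m) *
          (ℓ - j).choose (i - j) ≤ 0 := Finset.sum_nonpos fun j hj =>
        mul_nonpos_of_nonpos_of_nonneg
          (ih m (by omega) ((Finset.mem_range.1 hj).trans hi)) (by positivity)
      linarith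
    · rw [turanCliques_of_le _ h.le]
      interval_cases i
      · simp
      · simp [mul_div_cancel₀ _ hℓ']

/-- The Turán number is within `O(n^{r-2})` of its balanced continuous value. -/
theorem exists_turanDefect_le (ℓ : ℕ) (hℓ : 0 < ℓ) (r : ℕ) (hr : 2 ≤ r) :
    ∃ C : ℝ, 0 ≤ C ∧ ∀ n : ℕ,
      (ℓ.choose r : ℝ) * (n / ℓ : ℝ) ^ r - turanCliques ℓ r n ≤ C * ((n : ℝ) + 1) ^ (r - 2) := by
  have hℓ0 : (0 : ℝ) < ℓ := by exact_mod_cast hℓ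
  induction r using Nat.strong_induction_on with
  | _ r ih =>
    have hK : ∀ i, ∃ K : ℝ, 0 ≤ K ∧ (i < r → ∀ n : ℕ,
        ((ℓ.choose i : ℝ) * (n / ℓ : ℝ) ^ i - turanCliques ℓ i n) * (ℓ - i).choose (r - i) ≤
          K * ((n : ℝ) + 1) ^ (r - 3)) := by
      intro i
      rcases lt_or_ge i 2 with hi2 | hi2
      · refine ⟨0, le_rfl, fun _ n => ?_⟩
        rw [zero_mul]
        exact mul_nonpos_of_nonpos_of_nonneg (turanDefect_le_one_le ℓ n hℓ hi2) (by positivity)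
      · rcases lt_or_ge i r with hir | hir
        · obtain ⟨C, hC, h⟩ := ih i hir hi2
          refine ⟨C * (ℓ - i).choose (r - i), by positivity, fun _ n => ?_⟩
          calc _ ≤ C * ((n : ℝ) + 1) ^ (i - 2) * (ℓ - i).choose (r - i) := by
                gcongr; exact h n
            _ ≤ C * ((n : ℝ) + 1) ^ (r - 3) * (ℓ - i).choose (r - i) := by
                have := pow_le_pow_right₀ (by linarith [n.cast_nonneg (α := ℝ)] :
                  (1 : ℝ) ≤ (n : ℝ) + 1) (show i - 2 ≤ r - 3 by omega)
                gcongr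
            _ = _ := by ring
        · exact ⟨0, le_rfl, fun h => absurd h (by omega)⟩
    choose K hK0 hK using hK
    set S := ∑ i ∈ Finset.range r, K i with hS
    have hS0 : 0 ≤ S := Finset.sum_nonneg fun i _ => hK0 i
    have hstep : ∀ n : ℕ, ∑ i ∈ Finset.range r,
        ((ℓ.choose i : ℝ) * (n / ℓ : ℝ) ^ i - turanCliques ℓ i n) * (ℓ - i).choose (r - i) ≤
          if r = 2 then 0 else S * ((n : ℝ) + 1) ^ (r - 3) := by
      intro n
      split_ifs with h2
      · refine Finset.sum_nonpos fun i hi => ?_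
        have := Finset.mem_range.1 hi
        exact mul_nonpos_of_nonpos_of_nonneg (turanDefect_le_one_le ℓ n hℓ (by omega))
          (by positivity)
      · rw [hS, Finset.sum_mul]
        exact Finset.sum_le_sum fun i hi => hK i (Finset.mem_range.1 hi) n
    -- Each block of `ℓ` vertices adds lower-order defects of size `O(n^{r-3})`, and summing over
    -- the blocks costs one factor `n`. For `r = 2` the increments are nonpositive, and the
    -- truncated exponent `r - 3` would not give a constant bound.
    have hmain : ∀ n : ℕ, (ℓ.choose r : ℝ) * (n / ℓ : ℝ) ^ r - turanCliques ℓ r n ≤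
        ℓ.choose r + if r = 2 then 0 else S * (n * ((n : ℝ) + 1) ^ (r - 3)) := by
      intro n
      induction n using Nat.strong_induction_on with
      | _ n ihn =>
        rcases le_or_gt ℓ n with h | h
        · obtain ⟨m, rfl⟩ : ∃ m, n = m + ℓ := ⟨n - ℓ, by omega⟩
          rw [turanDefect_add _ _ _ hℓ]
          have h1 := ihn m (by omega)
          have h2 := hstep m
          split_ifs at h1 h2 ⊢ with hr2
          · linarith
          · have hm : (m : ℝ) + 1 ≤ (m + ℓ : ℕ) := by exact_mod_cast (by omega : m + 1 ≤ m + ℓ)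
            have h3 : ((m : ℝ) + 1) * ((m : ℝ) + 1) ^ (r - 3) ≤
                ((m + ℓ : ℕ) : ℝ) * (((m + ℓ : ℕ) : ℝ) + 1) ^ (r - 3) := by
              gcongr; linarith
            have h4 := mul_le_mul_of_nonneg_left h3 hS0
            linarith
        · have h1 : ((n : ℝ) / ℓ) ^ r ≤ 1 :=
            pow_le_one₀ (by positivity) ((div_le_one hℓ0).2 (by exact_mod_cast h.le))
          have h2 : (ℓ.choose r : ℝ) * (n / ℓ : ℝ) ^ r ≤ ℓ.choose r * 1 := by gcongr
          have h3 : (0 : ℝ) ≤ if r = 2 then 0 else S * (n * ((n : ℝ) + 1) ^ (r - 3)) := by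
            split_ifs <;> positivity
          have h4 : (0 : ℝ) ≤ turanCliques ℓ r n := by positivity
          linarith
    refine ⟨ℓ.choose r + S, by positivity, fun n => (hmain n).trans ?_⟩
    have hn : (1 : ℝ) ≤ (n : ℝ) + 1 := by linarith [n.cast_nonneg (α := ℝ)]
    have h1 : (ℓ.choose r : ℝ) * 1 ≤ ℓ.choose r * ((n : ℝ) + 1) ^ (r - 2) := by
      gcongr; exact one_le_pow₀ hn
    split_ifs with hr2
    · have : 0 ≤ S * ((n : ℝ) + 1) ^ (r - 2) := by positivity
      linarith
    · have h2 : S * (n * ((n : ℝ) + 1) ^ (r - 3)) ≤ S * ((n : ℝ) + 1) ^ (r - 2) := by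
        rw [show r - 2 = (r - 3) + 1 by omega, pow_succ']
        gcongr; linarith
      linarith

end TuranNumber

end SimpleGraph

/-! ### Füredi's stability argument -/

namespace SimpleGraph

variable {V : Type*}

section Partition

open Classical in
/-- The vertices outside the colour class of `v` that are not adjacent to `v`. -/
noncomputable def missing {κ : Type*} [Fintype V] (G : SimpleGraph V) (c : V → κ) (v : V) :
    Finset V :=
  Finset.univ.filter fun w => c w ≠ c v ∧ ¬ G.Adj v w

theorem mem_missing {κ : Type*} [Fintype V] {G : SimpleGraph V} {c : V → κ} {v w : V} :
    w ∈ G.missing c v ↔ c w ≠ c v ∧ ¬ G.Adj v w := by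
  simp [missing]

theorem sum_sum_split [DecidableEq V] {U U' : Finset V} (h : U' ⊆ U) {f : V → V → ℕ}
    (hf : ∀ x y, f x y = f y x) :
    ∑ x ∈ U, ∑ y ∈ U, f x y = ∑ x ∈ U', ∑ y ∈ U', f x y +
      ∑ x ∈ U \ U', ∑ y ∈ U \ U', f x y + 2 * ∑ x ∈ U \ U', ∑ y ∈ U', f x y := by
  have h1 : ∀ g : V → ℕ, ∑ x ∈ U, g x = ∑ x ∈ U \ U', g x + ∑ x ∈ U', g x := fun g =>
    (Finset.sum_sdiff h).symm
  have h2 : ∑ x ∈ U', ∑ y ∈ U \ U', f x y = ∑ x ∈ U \ U', ∑ y ∈ U', f x y := by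
    rw [Finset.sum_comm]
    exact Finset.sum_congr rfl fun x _ => Finset.sum_congr rfl fun y _ => hf y x
  rw [h1]
  simp only [h1 (fun y => f _ y), Finset.sum_add_distrib]
  rw [h2]
  ring

open Classical in
/-- Füredi's partition of a `K_{ℓ+1}`-free graph; all pairs are counted in both orders. -/
theorem exists_furedi_partition (G : SimpleGraph V) (ℓ : ℕ) :
    ∀ U : Finset V, G.CliqueFreeOn (U : Set V) (ℓ + 1) → ∃ c : V → ℕ, (∀ v ∈ U, c v < ℓ) ∧
      ∑ x ∈ U, ∑ y ∈ U, (if G.Adj x y then 1 else 0) +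
        ∑ x ∈ U, ∑ y ∈ U, (if G.Adj x y ∧ c x = c y then 1 else 0) ≤
      ∑ x ∈ U, ∑ y ∈ U, (if c x ≠ c y then 1 else 0) := by
  induction ℓ with
  | zero =>
    intro U hU
    have : U = ∅ := by
      refine Finset.eq_empty_of_forall_notMem fun v hv => ?_
      exact hU (t := {v}) (by simpa using hv) ⟨by simp, by simp⟩
    exact ⟨fun _ => 0, by simp [this], by simp [this]⟩
  | succ ℓ ih =>
    intro U hU
    rcases U.eq_empty_or_nonempty with rfl | hne
    · exact ⟨fun _ => 0, by simp, by simp⟩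
    obtain ⟨x₀, hx₀, hmax⟩ := Finset.exists_max_image U
      (fun v => (U.filter fun w => G.Adj v w).card) hne
    set U' := U.filter fun w => G.Adj x₀ w with hU'
    have hsub : U' ⊆ U := Finset.filter_subset _ _
    have hfree : G.CliqueFreeOn (U' : Set V) (ℓ + 1) := by
      intro t ht htc
      have ht' : t ⊆ U' := by exact_mod_cast ht
      refine hU (t := insert x₀ t) ?_ (htc.insert fun b hb => (Finset.mem_filter.1 (ht' hb)).2)
      exact_mod_cast Finset.insert_subset hx₀ (ht'.trans hsub)
    obtain ⟨c', hc', hle⟩ := ih U' hfree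
    set c : V → ℕ := fun v => if v ∈ U' then c' v else ℓ with hc
    have hcU' : ∀ v ∈ U', c v = c' v := fun v hv => by simp [hc, hv]
    have hcW : ∀ v ∈ U \ U', c v = ℓ := fun v hv => by simp [hc, (Finset.mem_sdiff.1 hv).2]
    have hcne : ∀ v ∈ U \ U', ∀ w ∈ U', c v ≠ c w := fun v hv w hw => by
      rw [hcW v hv, hcU' w hw]; exact (hc' w hw).ne'
    refine ⟨c, fun v hv => ?_, ?_⟩
    · by_cases h : v ∈ U'
      · rw [hcU' v h]; exact (hc' v h).trans (Nat.lt_succ_self ℓ)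
      · rw [hcW v (Finset.mem_sdiff.2 ⟨hv, h⟩)]; exact Nat.lt_succ_self ℓ
    -- Every vertex outside the neighbourhood `U'` of `x₀` has degree at most `U'.card`, by the
    -- maximality of `x₀`. Twice this inequality pays for the edges leaving `U'` and for those
    -- inside the new class.
    have hdeg : ∑ x ∈ U \ U', ∑ y ∈ U \ U', (if G.Adj x y then 1 else 0) +
        ∑ x ∈ U \ U', ∑ y ∈ U', (if G.Adj x y then 1 else 0) ≤ (U \ U').card * U'.card := by
      rw [← Finset.sum_add_distrib, ← smul_eq_mul]
      refine Finset.sum_le_card_nsmul _ _ _ fun v hv => ?_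
      rw [Finset.sum_sdiff hsub, ← Finset.sum_filter, ← Finset.card_eq_sum_ones]
      exact hmax v (Finset.mem_sdiff.1 hv).1
    have e1 : ∑ x ∈ U', ∑ y ∈ U', (if G.Adj x y ∧ c x = c y then 1 else 0) =
        ∑ x ∈ U', ∑ y ∈ U', (if G.Adj x y ∧ c' x = c' y then 1 else 0) :=
      Finset.sum_congr rfl fun x hx => Finset.sum_congr rfl fun y hy => by
        rw [hcU' x hx, hcU' y hy]
    have e2 : ∑ x ∈ U \ U', ∑ y ∈ U \ U', (if G.Adj x y ∧ c x = c y then 1 else 0) =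
        ∑ x ∈ U \ U', ∑ y ∈ U \ U', (if G.Adj x y then 1 else 0) :=
      Finset.sum_congr rfl fun x hx => Finset.sum_congr rfl fun y hy => by
        simp only [hcW x hx, hcW y hy, and_true]
    have e3 : ∑ x ∈ U \ U', ∑ y ∈ U', (if G.Adj x y ∧ c x = c y then 1 else 0) = 0 :=
      Finset.sum_eq_zero fun x hx => Finset.sum_eq_zero fun y hy => by
        simp [hcne x hx y hy]
    have e4 : ∑ x ∈ U', ∑ y ∈ U', (if c x ≠ c y then 1 else 0) =
        ∑ x ∈ U', ∑ y ∈ U', (if c' x ≠ c' y then 1 else 0) :=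
      Finset.sum_congr rfl fun x hx => Finset.sum_congr rfl fun y hy => by
        rw [hcU' x hx, hcU' y hy]
    have e5 : ∑ x ∈ U \ U', ∑ y ∈ U', (if c x ≠ c y then 1 else 0) =
        (U \ U').card * U'.card := by
      rw [Finset.sum_congr rfl fun x hx => Finset.sum_congr rfl fun y hy =>
        if_pos (hcne x hx y hy)]
      simp
    rw [sum_sum_split hsub (f := fun x y => if G.Adj x y then 1 else 0)
        (fun x y => by simp only [G.adj_comm]),
      sum_sum_split hsub (f := fun x y => if G.Adj x y ∧ c x = c y then 1 else 0)
        (fun x y => by simp only [G.adj_comm, eq_comm]),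
      sum_sum_split hsub (f := fun x y => if c x ≠ c y then 1 else 0)
        (fun x y => by simp only [ne_comm]), e1, e2, e3, e4, e5]
    have := Nat.zero_le (∑ x ∈ U \ U', ∑ y ∈ U \ U', (if c x ≠ c y then 1 else 0))
    omega

open Classical in
theorem sum_sum_adj_eq [Fintype V] (G : SimpleGraph V) :
    ∑ x : V, ∑ y : V, (if G.Adj x y then 1 else 0) = 2 * (G.cliquesIn Finset.univ 2).card := by
  have h := sum_card_commonIn G 1
  have h1 : G.cliquesIn Finset.univ 1 = Finset.univ.map ⟨fun v => {v}, Finset.singleton_injective⟩ := by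
    ext s
    rw [mem_cliquesIn, Finset.mem_map]
    constructor
    · rintro ⟨-, hs, -⟩
      obtain ⟨v, rfl⟩ := Finset.card_eq_one.1 hs
      exact ⟨v, Finset.mem_univ _, rfl⟩
    · rintro ⟨v, -, rfl⟩
      exact ⟨Finset.subset_univ _, by simp, by simp⟩
  rw [h1, Finset.sum_map] at h
  rw [← h]
  refine Finset.sum_congr rfl fun x _ => ?_
  rw [← Finset.sum_filter, ← Finset.card_eq_sum_ones]
  congr 1
  ext y
  simp [mem_commonIn]

open Classical in
/-- A `K_{ℓ+1}`-free graph with nearly as many edges as possible has a nearly balanced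
`ℓ`-partition with few missing edges across. -/
theorem exists_partition_of_cliqueFree [Fintype V] {G : SimpleGraph V} {ℓ : ℕ} (hℓ : 0 < ℓ)
    (hG : G.CliqueFree (ℓ + 1)) {δ : ℝ}
    (hδ : (1 - 1 / (ℓ : ℝ)) * (Fintype.card V : ℝ) ^ 2 -
      2 * (G.cliquesIn Finset.univ 2).card ≤ δ) :
    ∃ c : V → Fin ℓ, (∑ v, ((G.missing c v).card : ℝ) ≤ 2 * δ) ∧
      ∀ i, (((Finset.univ.filter fun v => c v = i).card : ℝ) - Fintype.card V / ℓ) ^ 2 ≤ δ := by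
  obtain ⟨c', hc', hle⟩ := exists_furedi_partition G ℓ Finset.univ hG.cliqueFreeOn
  rw [sum_sum_adj_eq] at hle
  set c : V → Fin ℓ := fun v => ⟨c' v, hc' v (Finset.mem_univ v)⟩ with hc
  have hcc : ∀ x y, c' x = c' y ↔ c x = c y := fun x y => by simp [hc]
  simp only [ne_eq, hcc] at hle
  set n : ℝ := (Fintype.card V : ℝ) with hn
  set p : Fin ℓ → ℝ := fun i => ((Finset.univ.filter fun v => c v = i).card : ℝ) with hp
  have hℓ0 : (0 : ℝ) < ℓ := by exact_mod_cast hℓ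
  have hsum : ∑ i, p i = n := by
    rw [hn, ← Finset.card_univ, Finset.card_eq_sum_card_fiberwise (f := c) (t := Finset.univ)
      (by simp)]
    push_cast
    rfl
  have hcross : ((∑ x : V, ∑ y : V, (if ¬ c x = c y then 1 else 0) : ℕ) : ℝ) =
      n ^ 2 - ∑ i, p i ^ 2 := by
    have h1 : ((∑ x : V, ∑ y : V, (if ¬ c x = c y then 1 else 0) : ℕ) : ℝ) =
        ∑ x : V, (n - p (c x)) := by
      push_cast
      refine Finset.sum_congr rfl fun x _ => ?_
      have : ∀ y, (if ¬ c x = c y then (1 : ℝ) else 0) = 1 - if c y = c x then 1 else 0 := by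
        intro y
        by_cases h : c x = c y
        · simp [h]
        · simp [h, Ne.symm h]
      simp only [this, Finset.sum_sub_distrib]
      simp [hp, hn]
    have h2 : ∑ x : V, p (c x) = ∑ i, p i ^ 2 := by
      rw [← Finset.sum_fiberwise_of_maps_to (s := Finset.univ) (t := Finset.univ) (g := c)
        (by simp)]
      refine Finset.sum_congr rfl fun i _ => ?_
      rw [Finset.sum_congr rfl (g := fun _ => p i) fun x hx => by
        rw [(Finset.mem_filter.1 hx).2], Finset.sum_const, nsmul_eq_mul, sq]
    rw [h1, Finset.sum_sub_distrib, h2, Finset.sum_const, nsmul_eq_mul, Finset.card_univ, sq]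
  have hvar : ∑ i, (p i - n / ℓ) ^ 2 = ∑ i, p i ^ 2 - n ^ 2 / ℓ := by
    have : ∀ i, (p i - n / ℓ) ^ 2 = p i ^ 2 - 2 * (n / ℓ) * p i + (n / ℓ) ^ 2 := fun i => by ring
    simp only [this, Finset.sum_add_distrib, Finset.sum_sub_distrib, ← Finset.mul_sum, hsum]
    simp only [Finset.sum_const, Finset.card_univ, Fintype.card_fin, nsmul_eq_mul]
    field_simp
    ring
  have hmiss : ((∑ v, (G.missing c v).card : ℕ) : ℝ) + 2 * (G.cliquesIn Finset.univ 2).card =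
      ((∑ x : V, ∑ y : V, (if ¬ c x = c y then 1 else 0) : ℕ) : ℝ) +
      ((∑ x : V, ∑ y : V, (if G.Adj x y ∧ c x = c y then 1 else 0) : ℕ) : ℝ) := by
    have : ∑ v, (G.missing c v).card + 2 * (G.cliquesIn Finset.univ 2).card =
      ∑ x : V, ∑ y : V, (if ¬ c x = c y then 1 else 0) +
      ∑ x : V, ∑ y : V, (if G.Adj x y ∧ c x = c y then 1 else 0) := by
      rw [← sum_sum_adj_eq, ← Finset.sum_add_distrib, ← Finset.sum_add_distrib]
      refine Finset.sum_congr rfl fun x _ => ?_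
      have h : (G.missing c x).card =
          ∑ y : V, if ¬ c x = c y ∧ ¬ G.Adj x y then 1 else 0 := by
        rw [← Finset.sum_filter, ← Finset.card_eq_sum_ones]
        congr 1
        ext y
        simp [mem_missing, eq_comm]
      rw [h, ← Finset.sum_add_distrib, ← Finset.sum_add_distrib]
      refine Finset.sum_congr rfl fun y _ => ?_
      by_cases h1 : c x = c y <;> by_cases h2 : G.Adj x y <;> simp [h1, h2]
    exact_mod_cast this
  have hle' : 2 * ((G.cliquesIn Finset.univ 2).card : ℝ) +
      ((∑ x : V, ∑ y : V, (if G.Adj x y ∧ c x = c y then 1 else 0) : ℕ) : ℝ) ≤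
      ((∑ x : V, ∑ y : V, (if ¬ c x = c y then 1 else 0) : ℕ) : ℝ) := by exact_mod_cast hle
  have hin : (0 : ℝ) ≤
      ((∑ x : V, ∑ y : V, (if G.Adj x y ∧ c x = c y then 1 else 0) : ℕ) : ℝ) := Nat.cast_nonneg _
  have hvar0 : 0 ≤ ∑ i, (p i - n / ℓ) ^ 2 := Finset.sum_nonneg fun i _ => sq_nonneg _
  rw [show (1 - 1 / (ℓ : ℝ)) * n ^ 2 = n ^ 2 - n ^ 2 / ℓ by ring] at hδ
  -- Füredi's inequality bounds the variance plus the number of monochromatic ordered pairs by `δ`.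
  -- Missing cross pairs equal cross pairs minus edges plus monochromatic edges, hence are at most
  -- `2 * δ`.
  refine ⟨c, ?_, fun i => ?_⟩
  · push_cast at hmiss hcross hle' hin ⊢
    linarith
  · have := Finset.single_le_sum (f := fun i => (p i - n / ℓ) ^ 2) (fun i _ => sq_nonneg _)
      (Finset.mem_univ i)
    push_cast at hmiss hcross hle' hin ⊢
    linarith

end Partition

/-! ### Deleting the vertices that spoil completeness -/

section Removal

variable [Fintype V] {ℓ : ℕ}

/-- Two vertices of one class with few missing neighbours each are not adjacent. -/
theorem not_adj_of_card_missing_le {G : SimpleGraph V} (hG : G.CliqueFree (ℓ + 1)) {c : V → Fin ℓ}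
    {A : Finset V} {t : ℕ} (hA : ∀ v ∉ A, (G.missing c v).card ≤ t)
    (hpart : ∀ i, A.card + ℓ * t < (Finset.univ.filter fun v => c v = i).card) {x y : V}
    (hx : x ∉ A) (hy : y ∉ A) (hxy : c x = c y) : ¬ G.Adj x y := by
  classical
  intro hadj
  -- A monochromatic edge is grown greedily by one vertex from each further class, avoiding `A` and
  -- all missing neighbours; exhausting the classes gives `ℓ + 1` vertices.
  have key : ∀ J : Finset (Fin ℓ), c x ∉ J → ∃ T : Finset V, G.IsNClique (J.card + 2) T ∧
      Disjoint T A ∧ ∀ v ∈ T, c v ∈ insert (c x) J := by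
    intro J
    induction J using Finset.induction_on with
    | empty =>
      intro _
      refine ⟨{x, y}, ⟨?_, ?_⟩, ?_, ?_⟩
      · simpa [Set.pairwise_insert, isClique_iff] using fun _ => ⟨hadj, hadj.symm⟩
      · rw [Finset.card_pair hadj.ne]; simp
      · simp [hx, hy]
      · simp [hxy]
    | insert j J hj ih =>
      intro hxJ
      rw [Finset.mem_insert, not_or] at hxJ
      obtain ⟨T, hT, hTA, hTc⟩ := ih hxJ.2
      have hJ : J.card + 2 ≤ ℓ := by
        have h1 : (insert (c x) (insert j J)).card ≤ (Finset.univ : Finset (Fin ℓ)).card :=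
          Finset.card_le_univ _
        rw [Finset.card_insert_of_notMem (by simp [hxJ]), Finset.card_insert_of_notMem hj] at h1
        simp only [Finset.card_univ, Fintype.card_fin] at h1
        omega
      have hcard : (A ∪ T.biUnion (G.missing c)).card ≤ A.card + ℓ * t := by
        refine (Finset.card_union_le _ _).trans (Nat.add_le_add_left ?_ _)
        refine (Finset.card_biUnion_le_card_mul _ _ t fun v hv =>
          hA v (Finset.disjoint_left.1 hTA hv)).trans ?_
        rw [hT.2]
        exact Nat.mul_le_mul_right _ hJ
      obtain ⟨w, hw, hwn⟩ := Finset.exists_mem_notMem_of_card_lt_card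
        (hcard.trans_lt (hpart j))
      have hwj : c w = j := (Finset.mem_filter.1 hw).2
      simp only [Finset.mem_union, Finset.mem_biUnion, not_or, not_exists, not_and] at hwn
      refine ⟨insert w T, ?_, ?_, ?_⟩
      · rw [Finset.card_insert_of_notMem hj, show J.card + 1 + 2 = J.card + 2 + 1 by omega]
        refine hT.insert fun b hb => ?_
        have := hwn.2 b hb
        rw [mem_missing, not_and, not_not] at this
        refine (this ?_).symm
        rw [hwj]
        rintro rfl
        rcases Finset.mem_insert.1 (hTc b hb) with h | h
        · exact hxJ.1 h.symm
        · exact hj h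
      · rw [Finset.disjoint_insert_left]
        exact ⟨hwn.1, hTA⟩
      · intro v hv
        rcases Finset.mem_insert.1 hv with rfl | hv
        · simp [hwj]
        · have := hTc v hv
          simp only [Finset.mem_insert] at this ⊢
          tauto
  obtain ⟨T, hT, -⟩ := key (Finset.univ.erase (c x)) (by simp)
  have hpos : 0 < ℓ := (c x).pos
  rw [Finset.card_erase_of_mem (Finset.mem_univ _), Finset.card_univ, Fintype.card_fin,
    show ℓ - 1 + 2 = ℓ + 1 by omega] at hT
  exact hT.not_cliqueFree hG

/-- Few vertices of `P` form, together with some vertex of `Q` and an `(ℓ-1)`-clique containing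
`T`, two `ℓ`-cliques sharing that clique. -/
theorem exists_small_cover [DecidableEq V] {G : SimpleGraph V} (hG : G.CliqueFree (ℓ + 1))
    {c : V → Fin ℓ} {A P Q : Finset V} {M : ℕ} (hM : 1 ≤ M) {i j : Fin ℓ} (hij : i ≠ j)
    (hA : ∀ v ∉ A, ∀ w ∉ A, c v = c w → ¬ G.Adj v w)
    (hP : ∀ v ∈ P, v ∉ A ∧ c v = i ∧ (G.missing c v).card ≤ M)
    (hQ : ∀ v ∈ Q, v ∉ A ∧ c v = j ∧ (G.missing c v).card ≤ M) (k : ℕ) :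
    ∀ T : Finset V, T.card + k + 1 = ℓ → ∃ X : Finset V, X.card ≤ (A.card + 2 * M) ^ k * M ∧
      ∀ x ∈ P, ∀ y ∈ Q, ∀ K : Finset V, G.IsNClique (ℓ - 1) K → T ⊆ K →
        (∀ v ∈ K, G.Adj v x) → (∀ v ∈ K, G.Adj v y) → x ∈ X := by
  -- `k` is the number of vertices of `K` outside `T`.
  induction k with
  | zero =>
    intro T hT
    rcases le_or_gt (G.commonIn P T).card M with hle | hlt
    · exact ⟨_, by simpa using hle, fun x hx y hy K hK hTK hKx hKy =>
        mem_commonIn.2 ⟨hx, fun v hv => hKx v (hTK hv)⟩⟩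
    refine ⟨∅, by simp, fun x hx y hy K hK hTK hKx hKy => ?_⟩
    have hTK : T = K := Finset.eq_of_subset_of_card_le hTK (by rw [hK.2]; omega)
    subst hTK
    obtain ⟨x', hx', hx'n⟩ := Finset.exists_mem_notMem_of_card_lt_card
      ((hQ y hy).2.2.trans_lt hlt)
    obtain ⟨hx'P, hx'T⟩ := mem_commonIn.1 hx'
    rw [mem_missing, not_and, not_not, (hP x' hx'P).2.1, (hQ y hy).2.1] at hx'n
    have hadj := hx'n hij
    have h1 := (hK.insert (a := x') fun b hb => (hx'T b hb).symm).insert (a := y) fun b hb => by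
      rcases Finset.mem_insert.1 hb with rfl | hb
      · exact hadj
      · exact (hKy b hb).symm
    rw [show ℓ - 1 + 1 + 1 = ℓ + 1 by omega] at h1
    exact absurd hG h1.not_cliqueFree
  | succ k ih =>
    intro T hT
    have hbase : 1 ≤ (A.card + 2 * M) ^ (k + 1) := Nat.one_le_pow _ _ (by omega)
    rcases le_or_gt (G.commonIn P T).card M with hle | hlt
    · exact ⟨_, hle.trans (Nat.le_mul_of_pos_left _ hbase), fun x hx y hy K hK hTK hKx hKy =>
        mem_commonIn.2 ⟨hx, fun v hv => hKx v (hTK hv)⟩⟩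
    rcases (G.commonIn Q T).eq_empty_or_nonempty with hempty | ⟨y', hy'⟩
    · refine ⟨∅, by simp, fun x hx y hy K hK hTK hKx hKy => ?_⟩
      have : y ∈ G.commonIn Q T := mem_commonIn.2 ⟨hy, fun v hv => hKy v (hTK hv)⟩
      simp [hempty] at this
    obtain ⟨hy'Q, hy'T⟩ := mem_commonIn.1 hy'
    obtain ⟨x', hx', hx'n⟩ := Finset.exists_mem_notMem_of_card_lt_card
      ((hQ y' hy'Q).2.2.trans_lt hlt)
    obtain ⟨hx'P, hx'T⟩ := mem_commonIn.1 hx'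
    rw [mem_missing, not_and, not_not, (hP x' hx'P).2.1, (hQ y' hy'Q).2.1] at hx'n
    have hadj := hx'n hij
    have hex : ∀ w, ∃ X : Finset V, X.card ≤ (A.card + 2 * M) ^ k * M ∧ (w ∉ T →
        ∀ x ∈ P, ∀ y ∈ Q, ∀ K : Finset V, G.IsNClique (ℓ - 1) K → insert w T ⊆ K →
        (∀ v ∈ K, G.Adj v x) → (∀ v ∈ K, G.Adj v y) → x ∈ X) := by
      intro w
      by_cases hw : w ∈ T
      · exact ⟨∅, by simp, fun h => absurd hw h⟩
      · obtain ⟨X, h1, h2⟩ := ih (insert w T)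
          (by rw [Finset.card_insert_of_notMem hw]; omega)
        exact ⟨X, h1, fun _ => h2⟩
    choose X hXc hX using hex
    set B := A ∪ (G.missing c x' ∪ G.missing c y') with hB
    have hBc : B.card ≤ A.card + 2 * M := by
      refine (Finset.card_union_le _ _).trans (Nat.add_le_add_left ?_ _)
      refine (Finset.card_union_le _ _).trans ?_
      have := (hP x' hx'P).2.2
      have := (hQ y' hy'Q).2.2
      omega
    refine ⟨B.biUnion X, ?_, fun x hx y hy K hK hTK hKx hKy => ?_⟩
    · refine (Finset.card_biUnion_le_card_mul _ _ _ fun w _ => hXc w).trans ?_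
      rw [pow_succ', mul_assoc]
      exact Nat.mul_le_mul_right _ hBc
    -- Otherwise `K`, `x'`, `y'` form an `(ℓ+1)`-clique: a vertex of `K` outside `A` cannot share
    -- the class of `x` or of `y`, being adjacent to both, so avoiding the missing sets makes it
    -- adjacent to `x'` and `y'`. The branching is therefore over `B` only.
    · have hmeet : ∃ w ∈ K, w ∉ T ∧ w ∈ B := by
        by_contra! hno
        have hx'K : ∀ b ∈ K, G.Adj x' b := fun b hb => by
          by_cases hbT : b ∈ T
          · exact (hx'T b hbT).symm
          have hbB := hno b hb hbT
          simp only [hB, Finset.mem_union, not_or, mem_missing, not_and, not_not] at hbB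
          refine hbB.2.1 fun h => ?_
          exact hA b hbB.1 x (hP x hx).1 (by rw [h, (hP x hx).2.1, (hP x' hx'P).2.1]) (hKx b hb)
        have hy'K : ∀ b ∈ K, G.Adj y' b := fun b hb => by
          by_cases hbT : b ∈ T
          · exact (hy'T b hbT).symm
          have hbB := hno b hb hbT
          simp only [hB, Finset.mem_union, not_or, mem_missing, not_and, not_not] at hbB
          refine hbB.2.2 fun h => ?_
          exact hA b hbB.1 y (hQ y hy).1 (by rw [h, (hQ y hy).2.1, (hQ y' hy'Q).2.1]) (hKy b hb)
        have h1 := (hK.insert (a := x') hx'K).insert (a := y') fun b hb => by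
          rcases Finset.mem_insert.1 hb with rfl | hb
          · exact hadj
          · exact hy'K b hb
        rw [show ℓ - 1 + 1 + 1 = ℓ + 1 by omega] at h1
        exact h1.not_cliqueFree hG
      obtain ⟨w, hwK, hwT, hwB⟩ := hmeet
      exact Finset.mem_biUnion.2 ⟨w, hwB,
        hX w hwT x hx y hy K hK (Finset.insert_subset hwK hTK) hKx hKy⟩

/-- After removing few vertices, a maximal `K_{ℓ+1}`-free graph whose colouring is proper outside
`A` becomes complete multipartite. -/
theorem exists_removal [DecidableEq V] {G : SimpleGraph V} (hℓ : 2 ≤ ℓ)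
    (hG : Maximal (fun H : SimpleGraph V => H.CliqueFree (ℓ + 1)) G)
    {c : V → Fin ℓ} {A : Finset V} {M : ℕ} (hM : 1 ≤ M)
    (hA : ∀ v ∉ A, ∀ w ∉ A, c v = c w → ¬ G.Adj v w) :
    ∃ X : Finset V, X.card ≤ ℓ ^ 2 * (A.card * ((A.card + 2 * M) ^ (ℓ - 2) * M)) ∧
      ∀ x y, x ∉ A → y ∉ A → (G.missing c x).card ≤ M → (G.missing c y).card ≤ M →
        x ∉ X → c x ≠ c y → G.Adj x y := by
  classical
  let P : Fin ℓ → Finset V := fun i =>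
    Finset.univ.filter fun v => v ∉ A ∧ c v = i ∧ (G.missing c v).card ≤ M
  have hP : ∀ i, ∀ v ∈ P i, v ∉ A ∧ c v = i ∧ (G.missing c v).card ≤ M := fun i v hv =>
    (Finset.mem_filter.1 hv).2
  have hex : ∀ q : (Fin ℓ × Fin ℓ) × V, ∃ X : Finset V,
      X.card ≤ (A.card + 2 * M) ^ (ℓ - 2) * M ∧ (q.1.1 ≠ q.1.2 →
      ∀ x ∈ P q.1.1, ∀ y ∈ P q.1.2, ∀ K : Finset V, G.IsNClique (ℓ - 1) K → {q.2} ⊆ K →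
        (∀ v ∈ K, G.Adj v x) → (∀ v ∈ K, G.Adj v y) → x ∈ X) := by
    rintro ⟨⟨i, j⟩, a⟩
    by_cases hij : i = j
    · exact ⟨∅, by simp, fun h => absurd hij h⟩
    · obtain ⟨X, h1, h2⟩ := exists_small_cover hG.1 hM hij hA (hP i) (hP j) (ℓ - 2) {a}
        (by rw [Finset.card_singleton]; omega)
      exact ⟨X, h1, fun _ => h2⟩
  choose X hXc hX using hex
  refine ⟨(Finset.univ ×ˢ A).biUnion X, ?_, ?_⟩
  · refine (Finset.card_biUnion_le_card_mul _ _ _ fun q _ => hXc q).trans (le_of_eq ?_)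
    rw [Finset.card_product, Finset.card_univ, Fintype.card_prod, Fintype.card_fin]
    ring
  · intro x y hxA hyA hxM hyM hxX hxy
    by_contra hadj
    have hne : x ≠ y := fun h => hxy (h ▸ rfl)
    obtain ⟨K, hxK, hyK, hKx, hKy⟩ := exists_of_maximal_cliqueFree_not_adj hG hne hadj
    have hadjx : ∀ v ∈ K, G.Adj v x := fun v hv =>
      hKx.1 (by simp [hv]) (by simp) (fun h => hxK (h ▸ hv))
    have hadjy : ∀ v ∈ K, G.Adj v y := fun v hv =>
      hKy.1 (by simp [hv]) (by simp) (fun h => hyK (h ▸ hv))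
    have hK : G.IsNClique (ℓ - 1) K := by
      refine ⟨hKx.1.subset (by simp), ?_⟩
      have := hKx.2
      rw [Finset.card_insert_of_notMem hxK] at this
      omega
    -- Outside `A` the `ℓ - 1` vertices of `K` would have distinct colours, all different from the
    -- two colours of `x` and `y`.
    have hmeet : ∃ a ∈ K, a ∈ A := by
      by_contra! hno
      have hinj : Set.InjOn c (K : Set V) := fun u hu v hv huv => by
        by_contra hne
        exact hA u (hno u hu) v (hno v hv) huv (hK.1 hu hv hne)
      have himg : K.image c ⊆ (Finset.univ.erase (c x)).erase (c y) := by
        intro z hz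
        obtain ⟨v, hv, rfl⟩ := Finset.mem_image.1 hz
        exact Finset.mem_erase.2 ⟨fun h => hA v (hno v hv) y hyA h (hadjy v hv),
          Finset.mem_erase.2 ⟨fun h => hA v (hno v hv) x hxA h (hadjx v hv),
            Finset.mem_univ _⟩⟩
      have hcard := Finset.card_le_card himg
      rw [Finset.card_image_of_injOn hinj, hK.2, Finset.card_erase_of_mem
        (Finset.mem_erase.2 ⟨Ne.symm hxy, Finset.mem_univ _⟩),
        Finset.card_erase_of_mem (Finset.mem_univ _), Finset.card_univ, Fintype.card_fin] at hcard
      omega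
    obtain ⟨a, haK, haA⟩ := hmeet
    refine hxX (Finset.mem_biUnion.2 ⟨((c x, c y), a), by simp [haA], ?_⟩)
    exact hX ((c x, c y), a) hxy x (by simp [P, hxA, hxM]) y (by simp [P, hyA, hyM]) K hK
      (by simpa using haK) hadjx hadjy

end Removal

end SimpleGraph

/-! ### Quantitative stability for maximal clique-free graphs -/

namespace SimpleGraph

theorem card_filter_lt_mul_le {V : Type*} [Fintype V] {f : V → ℕ} {S : ℝ}
    (hf : ∑ v, (f v : ℝ) ≤ S) (t : ℕ) {u : ℝ} (hu : u ≤ t + 1) :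
    ((Finset.univ.filter fun v => t < f v).card : ℝ) * u ≤ S := by
  calc ((Finset.univ.filter fun v => t < f v).card : ℝ) * u
      = ∑ v ∈ Finset.univ.filter (fun v => t < f v), u := by
        rw [Finset.sum_const, nsmul_eq_mul]
    _ ≤ ∑ v ∈ Finset.univ.filter (fun v => t < f v), (f v : ℝ) := by
        refine Finset.sum_le_sum fun v hv => hu.trans ?_
        exact_mod_cast (Finset.mem_filter.1 hv).2
    _ ≤ ∑ v, (f v : ℝ) :=
        Finset.sum_le_sum_of_subset_of_nonneg (Finset.subset_univ _) fun _ _ _ => by positivity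
    _ ≤ S := hf

set_option maxHeartbeats 1000000 in
/-- A maximal `K_{ℓ+1}`-free graph on `p ^ ℓ` vertices with `δ / 2` edges fewer than the balanced
value contains a complete `ℓ`-partite graph missing only `O(δ / p)` vertices. -/
theorem exists_large_completePartite {ℓ : ℕ} (hℓ : 2 ≤ ℓ) :
    ∃ C c₀ : ℝ, 0 < C ∧ 0 < c₀ ∧ ∀ (n : ℕ) (G : SimpleGraph (Fin n)) (p δ : ℝ), 1 ≤ p →
      p ^ ℓ = n → Maximal (fun H : SimpleGraph (Fin n) => H.CliqueFree (ℓ + 1)) G →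
      (1 - 1 / (ℓ : ℝ)) * (n : ℝ) ^ 2 - 2 * (G.cliquesIn Finset.univ 2).card ≤ δ →
      δ ≤ c₀ * (n * p) →
      ∃ (c : Fin n → Fin ℓ) (R : Finset (Fin n)), (∀ i, ∃ v ∈ R, c v = i) ∧
        (∀ x ∈ R, ∀ y ∈ R, c x ≠ c y → G.Adj x y) ∧
        (n : ℝ) - C * (δ / p) ≤ R.card ∧ (R = Finset.univ ∨ (n : ℝ) ≤ C * δ) := by
  classical
  have hℓ0 : (2 : ℝ) ≤ ℓ := by exact_mod_cast hℓ
  -- The summands bound the three deleted sets `A`, `B` and `X` below. The value of `c₀` then gives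
  -- `A.card ≤ p / (4ℓ)` and a total loss of at most `n / (4ℓ)`, less than any class.
  set C : ℝ := 8 * (ℓ : ℝ) ^ 2 + 2 + 8 * (ℓ : ℝ) ^ 4 * 6 ^ ℓ with hC
  have hC1 : 1 ≤ C := by
    have : 0 ≤ 8 * (ℓ : ℝ) ^ 2 := by positivity
    have : 0 ≤ 8 * (ℓ : ℝ) ^ 4 * 6 ^ ℓ := by positivity
    linarith
  have hC0 : 0 < C := by linarith
  refine ⟨C, 1 / (32 * (ℓ : ℝ) ^ 3 * C), hC0, by positivity, ?_⟩
  intro n G p δ hp hpn hG hδ hδ'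
  set N : ℝ := (n : ℝ) with hN
  have hp0 : 0 < p := by linarith
  have hN0 : 0 < N := by rw [← hpn]; positivity
  have hpN : p ≤ N := by
    rw [← hpn]; exact le_self_pow₀ hp (by omega)
  obtain ⟨c, hmiss, hsize⟩ := exists_partition_of_cliqueFree (by omega : 0 < ℓ) hG.1 (δ := δ)
    (by simpa using hδ)
  rw [Fintype.card_fin] at hsize
  have hδ0 : 0 ≤ δ := by
    have : 0 ≤ ∑ v, ((G.missing c v).card : ℝ) := Finset.sum_nonneg fun _ _ => by positivity
    linarith
  have hδC : C * (32 * (ℓ : ℝ) ^ 3 * δ) ≤ N * p := by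
    rw [div_mul_eq_mul_div, one_mul, le_div_iff₀ (by positivity)] at hδ'
    linarith
  have hδ1 : 32 * (ℓ : ℝ) ^ 3 * δ ≤ N * p := by
    refine le_trans ?_ hδC
    exact le_mul_of_one_le_left (by positivity) hC1
  have hδ2 : 32 * (ℓ : ℝ) ^ 3 * δ ≤ N ^ 2 := by
    refine hδ1.trans ?_
    rw [sq]; gcongr
  have hpart : ∀ i, 3 * N / (4 * ℓ) ≤ ((Finset.univ.filter fun v => c v = i).card : ℝ) := by
    intro i
    have h1 := hsize i
    have h2 : δ ≤ (N / (4 * ℓ)) ^ 2 := by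
      rw [div_pow, le_div_iff₀ (by positivity)]
      have : 0 ≤ (ℓ : ℝ) ^ 2 * δ := by positivity
      nlinarith
    have h3 := (abs_le_of_sq_le_sq' (h1.trans h2) (by positivity)).1
    have h4 : N / ℓ - N / (4 * ℓ) = 3 * N / (4 * ℓ) := by field_simp; ring
    linarith
  -- With this threshold `A.card` and `ℓ * t` are each at most `N / (4ℓ)`, while every class has at
  -- least `3N / (4ℓ)` vertices.
  set t : ℕ := ⌊N / (4 * (ℓ : ℝ) ^ 2)⌋₊ with ht
  set A := Finset.univ.filter fun v => t < (G.missing c v).card with hAdef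
  have hAc : (A.card : ℝ) * (N / (4 * (ℓ : ℝ) ^ 2)) ≤ 2 * δ :=
    card_filter_lt_mul_le hmiss t (Nat.lt_floor_add_one _).le
  have hAc' : (A.card : ℝ) ≤ 8 * (ℓ : ℝ) ^ 2 * (δ / N) := by
    rw [mul_div_assoc', div_le_iff₀ (by positivity)] at hAc
    rw [mul_div_assoc', le_div_iff₀ hN0]
    linarith
  have hAp : (A.card : ℝ) * (4 * ℓ) ≤ p := by
    have h1 : 8 * (ℓ : ℝ) ^ 2 * (δ / N) * (4 * ℓ) ≤ p := by
      rw [show 8 * (ℓ : ℝ) ^ 2 * (δ / N) * (4 * ℓ) = 32 * (ℓ : ℝ) ^ 3 * δ / N by ring,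
        div_le_iff₀ hN0]
      linarith
    exact le_trans (by gcongr) h1
  have htN : (ℓ : ℝ) * t ≤ N / (4 * ℓ) := by
    have h1 : (t : ℝ) ≤ N / (4 * (ℓ : ℝ) ^ 2) := Nat.floor_le (by positivity)
    calc (ℓ : ℝ) * t ≤ ℓ * (N / (4 * (ℓ : ℝ) ^ 2)) := by gcongr
      _ = N / (4 * ℓ) := by field_simp
  have hbig : ∀ i, A.card + ℓ * t < (Finset.univ.filter fun v => c v = i).card := by
    intro i
    have h1 := hpart i
    have h2 : (A.card : ℝ) ≤ N / (4 * ℓ) := by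
      rw [le_div_iff₀ (by positivity)]; linarith
    have h3 : 3 * N / (4 * ℓ) = N / (4 * ℓ) + N / (4 * ℓ) + N / (4 * ℓ) := by ring
    have h4 : 0 < N / (4 * ℓ) := by positivity
    have : ((A.card + ℓ * t : ℕ) : ℝ) < (Finset.univ.filter fun v => c v = i).card := by
      push_cast
      linarith
    exact_mod_cast this
  have hproper : ∀ v ∉ A, ∀ w ∉ A, c v = c w → ¬ G.Adj v w := fun v hv w hw hvw =>
    not_adj_of_card_missing_le hG.1 (t := t) (A := A)
      (fun v hv => by simpa [hAdef] using hv) hbig hv hw hvw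
  rcases A.eq_empty_or_nonempty with hA | hA
  · refine ⟨c, Finset.univ, fun i => ?_, fun x _ y _ hxy => ?_, ?_, Or.inl rfl⟩
    · obtain ⟨v, hv⟩ := Finset.card_pos.1 ((Nat.zero_le _).trans_lt (hbig i))
      exact ⟨v, Finset.mem_univ _, (Finset.mem_filter.1 hv).2⟩
    · refine adj_of_maximal_of_coloring hG (fun a b hab h => ?_) hxy
      exact hproper a (by simp [hA]) b (by simp [hA]) h hab
    · have : 0 ≤ C * (δ / p) := by positivity
      rw [Finset.card_univ, Fintype.card_fin]
      linarith
  set M : ℕ := ⌈p⌉₊ with hM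
  have hMp : p ≤ M := Nat.le_ceil p
  have hM2 : (M : ℝ) ≤ 2 * p := by
    have := Nat.ceil_lt_add_one hp0.le
    linarith
  have hM1 : 1 ≤ M := Nat.one_le_ceil_iff.2 hp0
  obtain ⟨X, hXc, hX⟩ := exists_removal hℓ hG hM1 hproper
  set B := Finset.univ.filter fun v => M < (G.missing c v).card with hBdef
  have hBc : (B.card : ℝ) * p ≤ 2 * δ :=
    card_filter_lt_mul_le hmiss M (by linarith)
  have hBc' : (B.card : ℝ) ≤ 2 * (δ / p) := by
    rw [mul_div_assoc', le_div_iff₀ hp0]; exact hBc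
  have hXc' : (X.card : ℝ) ≤ 8 * (ℓ : ℝ) ^ 4 * 6 ^ ℓ * (δ / p) := by
    have h1 : (A.card : ℝ) ≤ p := by
      have : (A.card : ℝ) * 1 ≤ A.card * (4 * ℓ) := by gcongr; linarith
      linarith
    have h2 : (X.card : ℝ) ≤
        (ℓ : ℝ) ^ 2 * (A.card * ((A.card + 2 * M) ^ (ℓ - 2) * M)) := by exact_mod_cast hXc
    have h3 : (A.card + 2 * M : ℝ) ≤ 6 * p := by linarith
    calc (X.card : ℝ) ≤ (ℓ : ℝ) ^ 2 * (A.card * ((A.card + 2 * M) ^ (ℓ - 2) * M)) := h2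
      -- The generous `36 * p` in place of `M ≤ 2 * p` completes `6 ^ (ℓ - 2)` to `6 ^ ℓ`; then `p ^
      -- (ℓ - 1) / N = 1 / p`.
      _ ≤ (ℓ : ℝ) ^ 2 * (8 * (ℓ : ℝ) ^ 2 * (δ / N) * ((6 * p) ^ (ℓ - 2) * (36 * p))) := by
          gcongr
          linarith
      _ = 8 * (ℓ : ℝ) ^ 4 * 6 ^ ℓ * (δ / p) := by
          obtain ⟨k, rfl⟩ : ∃ k, ℓ = k + 2 := ⟨ℓ - 2, by omega⟩
          rw [← hpn, Nat.add_sub_cancel]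
          field_simp
          ring
  have hAc'' : (A.card : ℝ) ≤ 8 * (ℓ : ℝ) ^ 2 * (δ / p) := by
    refine hAc'.trans ?_
    gcongr
  have hZ : ((A ∪ B ∪ X).card : ℝ) ≤ C * (δ / p) := by
    have h1 : ((A ∪ B ∪ X).card : ℝ) ≤ A.card + B.card + X.card := by
      exact_mod_cast (Finset.card_union_le _ _).trans
        (Nat.add_le_add_right (Finset.card_union_le _ _) _)
    rw [hC, add_mul, add_mul]
    linarith
  refine ⟨c, (A ∪ B ∪ X)ᶜ, fun i => ?_, fun x hx y hy hxy => ?_, ?_, Or.inr ?_⟩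
  · have h1 : C * (δ / p) ≤ N / (4 * ℓ) := by
      rw [mul_div_assoc', div_le_div_iff₀ hp0 (by positivity)]
      refine le_trans ?_ hδC
      rw [mul_assoc]
      refine mul_le_mul_of_nonneg_left ?_ hC0.le
      have h2 : 0 ≤ (ℓ : ℝ) * δ := by positivity
      have h3 : 4 ≤ (ℓ : ℝ) ^ 2 := by nlinarith
      nlinarith
    have h2 : N / (4 * ℓ) < 3 * N / (4 * ℓ) := by
      gcongr; linarith
    have h3 : (A ∪ B ∪ X).card < (Finset.univ.filter fun v => c v = i).card := by
      have := hpart i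
      have : ((A ∪ B ∪ X).card : ℝ) < (Finset.univ.filter fun v => c v = i).card := by linarith
      exact_mod_cast this
    obtain ⟨v, hv, hvn⟩ := Finset.exists_mem_notMem_of_card_lt_card h3
    exact ⟨v, by simpa using hvn, (Finset.mem_filter.1 hv).2⟩
  · simp only [Finset.mem_compl, Finset.mem_union, not_or] at hx hy
    refine hX x y hx.1.1 hy.1.1 ?_ ?_ hx.2 hxy
    · simpa [hBdef] using hx.1.2
    · simpa [hBdef] using hy.1.2
  · rw [Finset.card_compl, Fintype.card_fin, Nat.cast_sub (by
      simpa using Finset.card_le_univ (A ∪ B ∪ X))]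
    linarith
  · have h1 : (1 : ℝ) ≤ A.card := by exact_mod_cast hA.card_pos
    have h2 := h1.trans hAc'
    rw [mul_div_assoc', le_div_iff₀ hN0, one_mul] at h2
    refine h2.trans ?_
    gcongr
    rw [hC]
    have : 0 ≤ 8 * (ℓ : ℝ) ^ 4 * 6 ^ ℓ := by positivity
    linarith

end SimpleGraph

/-! ### Saturated `r`-graphs as clique hypergraphs -/

namespace RGraph

variable {r : ℕ} {V : Type*}

/-- The graph of pairs covered by an edge of `H`. -/
def shadow (H : RGraph r V) : SimpleGraph V where
  Adj x y := x ≠ y ∧ ∃ e ∈ H.edges, x ∈ e ∧ y ∈ e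
  symm := ⟨fun _ _ h => ⟨h.1.symm, h.2.imp fun _ he => ⟨he.1, he.2.2, he.2.1⟩⟩⟩
  loopless := ⟨fun _ h => h.1 rfl⟩

/-- One covering edge chosen for each pair of a `k`-clique gives at most `k.choose 2` edges, hence a
member of the family. -/
theorem cliqueFree_shadow {n k : ℕ} {H : RGraph r (Fin n)} (hH : H.IsFree (coverFamily r k)) :
    H.shadow.CliqueFree k := by
  classical
  intro S hS
  have hex : ∀ p : Finset (Fin n), ∃ e : Finset (Fin n),
      p ∈ S.powersetCard 2 → e ∈ H.edges ∧ p ⊆ e := by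
    intro p
    by_cases hp : p ∈ S.powersetCard 2
    · obtain ⟨hpS, hpc⟩ := Finset.mem_powersetCard.1 hp
      obtain ⟨x, y, hxy, rfl⟩ := Finset.card_eq_two.1 hpc
      obtain ⟨-, e, he, hxe, hye⟩ := hS.1 (hpS (by simp : x ∈ _)) (hpS (by simp : y ∈ _)) hxy
      exact ⟨e, fun _ => ⟨he, by simp [Finset.insert_subset_iff, hxe, hye]⟩⟩
    · exact ⟨∅, fun h => absurd h hp⟩
  choose f hf using hex
  let F : RGraph r (Fin n) :=
    { edges := (S.powersetCard 2).image f
      uniform := fun e he => by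
        obtain ⟨p, hp, rfl⟩ := Finset.mem_image.1 he
        exact H.uniform _ (hf p hp).1 }
  refine hH ⟨n, F⟩ ⟨?_, S, hS.2, fun x hx y hy hxy => ?_⟩ ⟨Function.Embedding.refl _, fun e he => ?_⟩
  · refine Finset.card_image_le.trans ?_
    rw [Finset.card_powersetCard, hS.2]
  · have hp : ({x, y} : Finset (Fin n)) ∈ S.powersetCard 2 := Finset.mem_powersetCard.2
      ⟨by simp [Finset.insert_subset_iff, hx, hy], Finset.card_pair hxy⟩
    exact ⟨f {x, y}, Finset.mem_image_of_mem f hp, (hf _ hp).2 (by simp), (hf _ hp).2 (by simp)⟩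
  · obtain ⟨p, hp, rfl⟩ := Finset.mem_image.1 he
    simpa using (hf p hp).1

theorem not_cliqueFree_shadow {k : ℕ} {H : RGraph r V} {F : Σ m : ℕ, RGraph r (Fin m)}
    (hF : F ∈ coverFamily r k) (h : H.Contains F.2) : ¬ H.shadow.CliqueFree k := by
  obtain ⟨f, hf⟩ := h
  obtain ⟨-, S, hS, hcov⟩ := hF
  intro hfree
  refine hfree (S.map f) ⟨?_, by simpa using hS⟩
  intro x hx y hy hxy
  obtain ⟨a, ha, rfl⟩ := Finset.mem_map.1 (Finset.mem_coe.1 hx)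
  obtain ⟨b, hb, rfl⟩ := Finset.mem_map.1 (Finset.mem_coe.1 hy)
  obtain ⟨e, he, hae, hbe⟩ := hcov a ha b hb (fun h => hxy (h ▸ rfl))
  exact ⟨hxy, e.map f, hf e he, Finset.mem_map_of_mem f hae, Finset.mem_map_of_mem f hbe⟩

/-- The edges of a saturated `r`-graph are the `r`-cliques of a maximal `K_{ℓ+1}`-free graph. -/
theorem IsSaturated.exists_maximal_cliqueFree {n ℓ : ℕ} {H : RGraph r (Fin n)}
    (hH : H.IsSaturated (coverFamily r (ℓ + 1))) :
    ∃ G : SimpleGraph (Fin n), Maximal (fun K : SimpleGraph (Fin n) => K.CliqueFree (ℓ + 1)) G ∧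
      H.edges = G.cliquesIn Finset.univ r := by
  obtain ⟨G, hle, hG⟩ := Finite.exists_le_maximal
    (p := fun K : SimpleGraph (Fin n) => K.CliqueFree (ℓ + 1)) (cliqueFree_shadow hH.1)
  refine ⟨G, hG, Finset.Subset.antisymm (fun e he => ?_) fun E hE => ?_⟩
  · exact SimpleGraph.mem_cliquesIn.2 ⟨Finset.subset_univ _, H.uniform e he,
      fun x hx y hy hxy => hle ⟨hxy, e, he, hx, hy⟩⟩
  · obtain ⟨-, hEr, hEc⟩ := SimpleGraph.mem_cliquesIn.1 hE
    by_contra hEH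
    obtain ⟨F, hF, hcon⟩ := hH.2 E hEr hEH
    -- Since `E` is a clique of `G`, adding it to `H` keeps the shadow inside `G`.
    refine not_cliqueFree_shadow hF hcon (hG.1.anti ?_)
    rintro x y ⟨hxy, e, he, hx, hy⟩
    rcases Finset.mem_insert.1 he with rfl | he
    · exact hEc hx hy hxy
    · exact hle ⟨hxy, e, he, hx, hy⟩

theorem containsCompletePartite_of_adj {H : RGraph r V} {G : SimpleGraph V} {ℓ m : ℕ}
    (hG : ∀ E : Finset V, E.card = r → G.IsClique (E : Set V) → E ∈ H.edges) (f : Fin m ↪ V)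
    (c : Fin m → Fin ℓ) (hc : Function.Surjective c)
    (h : ∀ x y, c x ≠ c y → G.Adj (f x) (f y)) : H.ContainsCompletePartite ℓ m := by
  refine ⟨c, hc, f, fun e he => ?_⟩
  obtain ⟨hecard, hepart⟩ := SimpleGraph.mem_completePartite.1 he
  refine hG _ (by simpa using hecard) ?_
  intro x hx y hy hxy
  obtain ⟨a, ha, rfl⟩ := Finset.mem_map.1 (Finset.mem_coe.1 hx)
  obtain ⟨b, hb, rfl⟩ := Finset.mem_map.1 (Finset.mem_coe.1 hy)
  exact h a b fun hab => hxy (congrArg f (hepart a ha b hb hab))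

end RGraph

/-! ### From a deficit of `r`-cliques to a deficit of edges -/

namespace SimpleGraph

theorem exists_edgeDefect_le {ℓ r : ℕ} (hr : 3 ≤ r) (hrℓ : r ≤ ℓ) :
    ∃ C : ℝ, 0 < C ∧ ∀ (n : ℕ) (G : SimpleGraph (Fin n)), 0 < n → G.CliqueFree (ℓ + 1) →
      (1 - 1 / (ℓ : ℝ)) * (n : ℝ) ^ 2 - 2 * (G.cliquesIn Finset.univ 2).card ≤
        C * (((turanCliques ℓ r n : ℝ) - (G.cliquesIn Finset.univ r).card) / (n : ℝ) ^ (r - 2)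
          + 1) := by
  obtain ⟨j, rfl⟩ : ∃ j, r = j + 2 := ⟨r - 2, by omega⟩
  simp only [Nat.add_sub_cancel]
  obtain ⟨E, hE0, hE⟩ := exists_turanDefect_le ℓ (by omega) (j + 2) (by omega)
  have hℓ0 : (0 : ℝ) < ℓ := by exact_mod_cast (by omega : 0 < ℓ)
  have hc2 : (ℓ.choose 2 : ℝ) = ℓ * (ℓ - 1) / 2 := Nat.cast_choose_two ℝ ℓ
  have hc2pos : (0 : ℝ) < ℓ.choose 2 := by exact_mod_cast Nat.choose_pos (by omega)
  have hcrpos : (0 : ℝ) < ℓ.choose (j + 2) := by exact_mod_cast Nat.choose_pos (by omega)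
  set B : ℝ := 2 * ℓ.choose 2 * ℓ ^ j / ℓ.choose (j + 2) with hB
  have hB0 : 0 < B := by positivity
  refine ⟨B * (E * 2 ^ j + 1), by positivity, fun n G hn hG => ?_⟩
  have hn0 : (0 : ℝ) < n := by exact_mod_cast hn
  have hkey := card_cliquesIn_mul_le hG j hrℓ
  rw [Fintype.card_fin] at hkey
  have hEn := hE n
  rw [Nat.add_sub_cancel] at hEn
  set k2 : ℝ := ((G.cliquesIn Finset.univ 2).card : ℝ)
  set kr : ℝ := ((G.cliquesIn Finset.univ (j + 2)).card : ℝ) with hkr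
  set T : ℝ := (turanCliques ℓ (j + 2) n : ℝ) with hT
  have hTk : 0 ≤ T - kr := by
    rw [hT, hkr, sub_nonneg]
    exact_mod_cast card_cliquesIn_le_turanCliques (by omega) n G Finset.univ (by simp)
      hG.cliqueFreeOn (j + 2)
  have hpow : ((n : ℝ) + 1) ^ j ≤ 2 ^ j * (n : ℝ) ^ j := by
    rw [← mul_pow]
    have : (1 : ℝ) ≤ n := by exact_mod_cast hn
    gcongr
    linarith
  set w : ℝ := ℓ.choose (j + 2) * (n / ℓ : ℝ) ^ j with hw
  have hw0 : 0 < w := by positivity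
  have h1 : (w * (n / ℓ : ℝ) ^ 2 - E * (2 ^ j * (n : ℝ) ^ j) - (T - kr)) * ℓ.choose 2 ≤
      k2 * w := by
    refine le_trans ?_ hkey
    gcongr
    have h2 : E * ((n : ℝ) + 1) ^ j ≤ E * (2 ^ j * (n : ℝ) ^ j) := by gcongr
    have h3 : (ℓ.choose (j + 2) : ℝ) * (n / ℓ : ℝ) ^ (j + 2) = w * (n / ℓ : ℝ) ^ 2 := by
      rw [hw]; ring
    linarith
  have h2 : (1 - 1 / (ℓ : ℝ)) * (n : ℝ) ^ 2 = 2 * ((n / ℓ : ℝ) ^ 2 * ℓ.choose 2) := by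
    rw [hc2]; field_simp
  have h3 : (n / ℓ : ℝ) ^ 2 * ℓ.choose 2 - k2 ≤
      (E * (2 ^ j * (n : ℝ) ^ j) + (T - kr)) * ℓ.choose 2 / w := by
    rw [le_div_iff₀ hw0]
    linarith
  have h4 : 2 * ((E * (2 ^ j * (n : ℝ) ^ j) + (T - kr)) * ℓ.choose 2 / w) =
      B * (E * 2 ^ j + (T - kr) / (n : ℝ) ^ j) := by
    rw [hw, hB, div_pow]
    field_simp
  have h5 : 0 ≤ (T - kr) / (n : ℝ) ^ j := by positivity
  calc (1 - 1 / (ℓ : ℝ)) * (n : ℝ) ^ 2 - 2 * k2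
      ≤ B * (E * 2 ^ j + (T - kr) / (n : ℝ) ^ j) := by linarith
    _ ≤ B * ((E * 2 ^ j + 1) * ((T - kr) / (n : ℝ) ^ j + 1)) := by
        gcongr
        have : 0 ≤ E * 2 ^ j * ((T - kr) / (n : ℝ) ^ j) := by positivity
        linarith
    _ = _ := by ring

end SimpleGraph

/-! ### The core estimate for saturated `r`-graphs -/

namespace RGraph

open SimpleGraph

/-- A saturated `r`-graph with `D` edges fewer than the Turán number contains a complete
`ℓ`-partite `r`-graph missing only `O(D / n^{r-2+1/ℓ})` vertices. -/
theorem exists_containsCompletePartite {ℓ r : ℕ} (hr : 3 ≤ r) (hrℓ : r ≤ ℓ) :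
    ∃ C : ℝ, 0 < C ∧ ∀ n : ℕ, ℓ < n → ∀ H : RGraph r (Fin n),
      H.IsSaturated (coverFamily r (ℓ + 1)) →
      H.edges.card ≤ turanNumber r n ℓ ∧ ∃ m : ℕ,
        (n : ℝ) - C * (((turanNumber r n ℓ : ℝ) - H.edges.card) /
          ((n : ℝ) ^ (r - 2) * (n : ℝ) ^ (1 / (ℓ : ℝ)))) ≤ m ∧
        H.ContainsCompletePartite ℓ m := by
  obtain ⟨C₁, c₀, hC₁, hc₀, hstruct⟩ := exists_large_completePartite (ℓ := ℓ) (by omega)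
  obtain ⟨C₂, hC₂, hdefect⟩ := exists_edgeDefect_le hr hrℓ
  obtain ⟨N₀, hN₀⟩ := exists_nat_ge (2 * C₂ / c₀ + 2 * C₁ * C₂)
  refine ⟨(N₀ : ℝ) ^ r + 2 * C₂ / c₀ + 2 * C₁ * C₂, by positivity, fun n hn H hH => ?_⟩
  obtain ⟨G, hG, hHG⟩ := hH.exists_maximal_cliqueFree
  have hmemH : ∀ E : Finset (Fin n), E.card = r → G.IsClique (E : Set (Fin n)) → E ∈ H.edges :=
    fun E h1 h2 => hHG ▸ mem_cliquesIn.2 ⟨Finset.subset_univ _, h1, h2⟩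
  have hle : H.edges.card ≤ turanNumber r n ℓ := by
    rw [turanNumber_eq_turanCliques, hHG]
    exact card_cliquesIn_le_turanCliques (by omega) n G Finset.univ (by simp)
      hG.1.cliqueFreeOn r
  refine ⟨hle, ?_⟩
  have hn1 : (1 : ℝ) ≤ n := by exact_mod_cast (by omega : 1 ≤ n)
  have hn0 : (0 : ℝ) < n := by linarith
  have hℓ1 : (1 : ℝ) ≤ ℓ := by exact_mod_cast (by omega : 1 ≤ ℓ)
  set p : ℝ := (n : ℝ) ^ (1 / (ℓ : ℝ)) with hp
  have hp1 : 1 ≤ p := Real.one_le_rpow hn1 (by positivity)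
  have hp0 : 0 < p := by linarith
  have hpn : p ^ ℓ = n := by
    rw [hp, ← Real.rpow_natCast, ← Real.rpow_mul hn0.le, one_div,
      inv_mul_cancel₀ (by linarith), Real.rpow_one]
  have hple : p ≤ n := by
    rw [← hpn]; exact le_self_pow₀ hp1 (by omega)
  set D : ℝ := (turanNumber r n ℓ : ℝ) - H.edges.card with hD
  set C : ℝ := (N₀ : ℝ) ^ r + 2 * C₂ / c₀ + 2 * C₁ * C₂ with hC
  have hC0 : 0 < C := by positivity
  have hD0 : 0 ≤ D := sub_nonneg.2 (by exact_mod_cast hle)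
  have hcol : ∀ (c : Fin n → Fin ℓ) (R : Finset (Fin n)), (∀ i, ∃ v ∈ R, c v = i) →
      (∀ x ∈ R, ∀ y ∈ R, c x ≠ c y → G.Adj x y) → H.ContainsCompletePartite ℓ R.card := by
    intro c R hsurj hadj
    refine containsCompletePartite_of_adj hmemH
      (R.equivFin.symm.toEmbedding.trans (Function.Embedding.subtype _))
      (fun x => c (R.equivFin.symm x)) (fun i => ?_)
      (fun x y hxy => hadj _ (R.equivFin.symm x).2 _ (R.equivFin.symm y).2 hxy)
    obtain ⟨v, hv, hvi⟩ := hsurj i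
    exact ⟨R.equivFin ⟨v, hv⟩, by simpa using hvi⟩
  rcases hle.eq_or_lt with heq | hlt
  · obtain ⟨c, hsurj, hadj⟩ := exists_completePartition_of_turanCliques_le (by omega : 2 ≤ r) hrℓ
      hG (by simpa using hn) (by
        rw [Fintype.card_fin, ← turanNumber_eq_turanCliques, ← hHG, heq])
    refine ⟨_, ?_, hcol c Finset.univ (fun i => ?_) fun x _ y _ => hadj x y⟩
    · rw [Finset.card_univ, Fintype.card_fin]
      have : 0 ≤ C * (D / ((n : ℝ) ^ (r - 2) * p)) := by positivity
      linarith
    · obtain ⟨v, hv⟩ := hsurj i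
      exact ⟨v, Finset.mem_univ _, hv⟩
  have hD1 : 1 ≤ D := by
    have : ((H.edges.card + 1 : ℕ) : ℝ) ≤ turanNumber r n ℓ := by exact_mod_cast hlt
    push_cast at this
    linarith
  set q : ℝ := D / (n : ℝ) ^ (r - 2) with hq
  have hq0 : 0 < q := by positivity
  rw [show D / ((n : ℝ) ^ (r - 2) * p) = q / p by rw [hq, div_div]]
  -- If the permitted loss is at least `n`, an `ℓ`-clique of `G` with singleton parts suffices.
  have htriv : (n : ℝ) ≤ C * (q / p) → ∃ m : ℕ, (n : ℝ) - C * (q / p) ≤ m ∧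
      H.ContainsCompletePartite ℓ m := by
    intro h
    obtain ⟨Q, hQ⟩ := exists_isNClique_of_maximal hG (by simpa using hn)
    refine ⟨ℓ, ?_, containsCompletePartite_of_adj hmemH
      ((Q.equivFinOfCardEq hQ.2).symm.toEmbedding.trans (Function.Embedding.subtype _)) id
      Function.surjective_id fun x y hxy => ?_⟩
    · have : (0 : ℝ) ≤ ℓ := by positivity
      linarith
    · refine hQ.1 ((Q.equivFinOfCardEq hQ.2).symm x).2 ((Q.equivFinOfCardEq hQ.2).symm y).2 ?_
      intro h
      exact hxy (by simpa using h)
  rcases lt_or_ge n N₀ with hsmall | hlarge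
  · refine htriv ?_
    -- As `D ≥ 1`, the loss term cannot be smaller than this; the summand `N₀ ^ r` of `C`
    -- compensates for bounded `n`.
    have h1 : 1 / (n : ℝ) ^ (r - 1) ≤ q / p := by
      rw [hq, div_div]
      refine div_le_div₀ (by positivity) hD1 (by positivity) ?_
      rw [show r - 1 = (r - 2) + 1 by omega, pow_succ]
      gcongr
    have h2 : (n : ℝ) ^ r ≤ C := by
      have h3 : (n : ℝ) ^ r ≤ (N₀ : ℝ) ^ r := by gcongr
      have h4 : 0 ≤ 2 * C₂ / c₀ + 2 * C₁ * C₂ := by positivity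
      linarith
    calc (n : ℝ) = (n : ℝ) ^ r * (1 / (n : ℝ) ^ (r - 1)) := by
          obtain ⟨k, rfl⟩ : ∃ k, r = k + 1 := ⟨r - 1, by omega⟩
          rw [Nat.add_sub_cancel]
          field_simp
          ring
      _ ≤ C * (q / p) := by gcongr
  have hN : 2 * C₂ / c₀ + 2 * C₁ * C₂ ≤ n := hN₀.trans (by exact_mod_cast hlarge)
  have hN1 : 2 * C₂ ≤ c₀ * n := by
    have h1 : 2 * C₂ / c₀ ≤ n := by
      have : 0 ≤ 2 * C₁ * C₂ := by positivity
      linarith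
    rw [div_le_iff₀ hc₀] at h1
    linarith
  have hN2 : 2 * C₁ * C₂ ≤ n := by
    have : 0 ≤ 2 * C₂ / c₀ := by positivity
    linarith
  have hδ := hdefect n G (by omega) hG.1
  rw [← hHG, ← turanNumber_eq_turanCliques, ← hD, ← hq] at hδ
  set δ : ℝ := (1 - 1 / (ℓ : ℝ)) * (n : ℝ) ^ 2 - 2 * (G.cliquesIn Finset.univ 2).card with hδdef
  rcases lt_or_ge (c₀ * (n * p)) δ with hbig | hδle
  · refine htriv ?_
    have h1 : c₀ * n ≤ c₀ * (n * p) := by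
      gcongr
      exact le_mul_of_one_le_right hn0.le hp1
    have h2 : c₀ * (n * p) ≤ 2 * C₂ * q := by linarith
    calc (n : ℝ) = c₀ * (n * p) / (c₀ * p) := by field_simp
      _ ≤ 2 * C₂ * q / (c₀ * p) := by gcongr
      _ = (2 * C₂ / c₀) * (q / p) := by field_simp
      _ ≤ C * (q / p) := by
        gcongr
        have h3 : 0 ≤ (N₀ : ℝ) ^ r := by positivity
        have h4 : 0 ≤ 2 * C₁ * C₂ := by positivity
        linarith
  obtain ⟨c, R, hsurj, hadj, hcard, hR⟩ := hstruct n G p δ hp1 hpn hG le_rfl hδle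
  refine ⟨_, ?_, hcol c R hsurj hadj⟩
  rcases hR with rfl | hR
  · rw [Finset.card_univ, Fintype.card_fin]
    have : 0 ≤ C * (q / p) := by positivity
    linarith
  · have h1 : C₁ * δ ≤ C₁ * (C₂ * (q + 1)) := by gcongr
    -- From `n ≤ C₁ * δ ≤ C₁ * C₂ * (q + 1)` and `2 * C₁ * C₂ ≤ n`; the additive `1` is now absorbed
    -- into `q`.
    have hq1 : 1 ≤ q := by
      have h2 : C₁ * C₂ * 1 ≤ C₁ * C₂ * q := by linarith
      exact le_of_mul_le_mul_left h2 (by positivity)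
    have h3 : δ ≤ 2 * C₂ * q := by
      have : C₂ * 1 ≤ C₂ * q := by gcongr
      linarith
    have h4 : C₁ * (δ / p) ≤ C * (q / p) := by
      calc C₁ * (δ / p) ≤ C₁ * (2 * C₂ * q / p) := by gcongr
        _ = (2 * C₁ * C₂) * (q / p) := by ring
        _ ≤ C * (q / p) := by
          gcongr
          have h3 : 0 ≤ (N₀ : ℝ) ^ r := by positivity
          have h4 : 0 ≤ 2 * C₂ / c₀ := by positivity
          linarith
    linarith

end RGraph

/-! ### The two forms of the theorem -/

theorem mainTheorem1 (ℓ : ℕ) :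
    -- the quantitative form; the constant depends only on `ℓ`
    (∃ C : ℝ, 0 < C ∧
      ∀ r n : ℕ, 3 ≤ r → r ≤ ℓ → 10 ^ 20 * ℓ ^ 20 ≤ n →
      ∀ ε : ℝ, ε ≤ (n : ℝ) ^ (1 / (ℓ : ℝ) - 1) →
      ∀ H : RGraph r (Fin n), H.IsSaturated (RGraph.coverFamily r (ℓ + 1)) →
        (RGraph.turanNumber r n ℓ : ℝ)
            - ((ℓ.choose r : ℝ) * r * ε) / (4 * ((ℓ : ℝ) - 1) * (ℓ : ℝ) ^ (r - 1)) * (n : ℝ) ^ r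
          ≤ (H.edges.card : ℝ) →
        ∃ m : ℕ,
          (1 - C * ε * (n : ℝ) ^ (1 - 1 / (ℓ : ℝ))
              - 10 ^ 6 * (ℓ : ℝ) ^ 3 * (3 * (r : ℝ) - 4) ^ 3 * ε) * n ≤ (m : ℝ) ∧
          H.ContainsCompletePartite ℓ m) ∧
    -- the asymptotic form
    (∀ r : ℕ, 3 ≤ r → r ≤ ℓ →
      ∀ f : ℕ → ℝ, f =o[atTop] (fun n : ℕ => (n : ℝ) ^ ((r : ℝ) - 1 + 1 / (ℓ : ℝ))) →
      ∃ g : ℕ → ℝ, Tendsto g atTop (nhds 0) ∧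
        ∀ᶠ n : ℕ in atTop, ∀ H : RGraph r (Fin n),
          H.IsSaturated (RGraph.coverFamily r (ℓ + 1)) →
          (RGraph.turanNumber r n ℓ : ℝ) - f n ≤ (H.edges.card : ℝ) →
          ∃ m : ℕ, (1 - g n) * n ≤ (m : ℝ) ∧ H.ContainsCompletePartite ℓ m) := by
  have hcore : ∀ r : ℕ, ∃ C : ℝ, 0 < C ∧ (3 ≤ r → r ≤ ℓ → ∀ n : ℕ, ℓ < n →
      ∀ H : RGraph r (Fin n), H.IsSaturated (RGraph.coverFamily r (ℓ + 1)) →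
      H.edges.card ≤ RGraph.turanNumber r n ℓ ∧ ∃ m : ℕ,
        (n : ℝ) - C * (((RGraph.turanNumber r n ℓ : ℝ) - H.edges.card) /
          ((n : ℝ) ^ (r - 2) * (n : ℝ) ^ (1 / (ℓ : ℝ)))) ≤ m ∧
        H.ContainsCompletePartite ℓ m) := by
    intro r
    by_cases h : 3 ≤ r ∧ r ≤ ℓ
    · obtain ⟨C, hC, hC'⟩ := RGraph.exists_containsCompletePartite h.1 h.2
      exact ⟨C, hC, fun _ _ => hC'⟩
    -- A default constant outside the range of `r`, so that the constants form a function of `r` and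
    -- can be summed over `r ≤ ℓ`.
    · exact ⟨1, one_pos, fun h1 h2 => absurd ⟨h1, h2⟩ h⟩
  choose C hC hcore using hcore
  constructor
  · let a : ℕ → ℝ := fun r =>
      |((ℓ.choose r : ℝ) * r) / (4 * ((ℓ : ℝ) - 1) * (ℓ : ℝ) ^ (r - 1))|
    have hCa : ∀ r, 0 ≤ C r * a r := fun r => mul_nonneg (hC r).le (abs_nonneg _)
    refine ⟨∑ r ∈ Finset.range (ℓ + 1), C r * a r + 1,
      add_pos_of_nonneg_of_pos (Finset.sum_nonneg fun r _ => hCa r) one_pos, ?_⟩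
    intro r n hr hrℓ hn ε _ H hH hcard
    have hℓn : ℓ < n := by
      have h0 : 0 < ℓ := by omega
      have h1 : ℓ ≤ ℓ ^ 20 := Nat.le_self_pow (by norm_num) ℓ
      have h2 : 0 < ℓ ^ 20 := by positivity
      omega
    obtain ⟨hle, m, hm, hcontains⟩ := hcore r hr hrℓ n hℓn H hH
    refine ⟨m, le_trans ?_ hm, hcontains⟩
    have hn0 : (0 : ℝ) < n := by exact_mod_cast (by omega : 0 < n)
    have hℓ3 : (3 : ℝ) ≤ ℓ := by exact_mod_cast hr.trans hrℓ
    have hr3 : (3 : ℝ) ≤ r := by exact_mod_cast hr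
    have hch : (0 : ℝ) < ℓ.choose r := by exact_mod_cast Nat.choose_pos hrℓ
    have hden : 0 < 4 * ((ℓ : ℝ) - 1) * (ℓ : ℝ) ^ (r - 1) := by
      have : (0 : ℝ) < ℓ - 1 := by linarith
      positivity
    have ha : a r = ((ℓ.choose r : ℝ) * r) / (4 * ((ℓ : ℝ) - 1) * (ℓ : ℝ) ^ (r - 1)) :=
      abs_of_pos (by positivity)
    have ha0 : 0 < a r := by rw [ha]; positivity
    set D : ℝ := (RGraph.turanNumber r n ℓ : ℝ) - H.edges.card with hD
    have hD0 : 0 ≤ D := sub_nonneg.2 (by exact_mod_cast hle)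
    have hDε : D ≤ a r * ε * (n : ℝ) ^ r := by
      have : ((ℓ.choose r : ℝ) * r * ε) / (4 * ((ℓ : ℝ) - 1) * (ℓ : ℝ) ^ (r - 1)) = a r * ε := by
        rw [ha]; ring
      rw [this] at hcard
      linarith
    -- The deficit is nonnegative by Zykov's theorem, so the edge hypothesis excludes negative `ε`.
    have hε : 0 ≤ ε := by
      by_contra! hneg
      have : a r * ε * (n : ℝ) ^ r < 0 :=
        mul_neg_of_neg_of_pos (mul_neg_of_pos_of_neg ha0 hneg) (by positivity)
      linarith
    set p : ℝ := (n : ℝ) ^ (1 / (ℓ : ℝ)) with hp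
    have hp0 : 0 < p := Real.rpow_pos_of_pos hn0 _
    have hpow : (n : ℝ) ^ (1 - 1 / (ℓ : ℝ)) = n / p := by
      rw [Real.rpow_sub hn0, Real.rpow_one]
    rw [hpow]
    have h1 : D / ((n : ℝ) ^ (r - 2) * p) ≤ a r * (ε * (n / p) * n) := by
      rw [div_le_iff₀ (by positivity)]
      refine hDε.trans_eq ?_
      obtain ⟨k, rfl⟩ : ∃ k, r = k + 2 := ⟨r - 2, by omega⟩
      rw [Nat.add_sub_cancel]
      field_simp
      ring
    have h2 : C r * a r ≤ ∑ r ∈ Finset.range (ℓ + 1), C r * a r + 1 := by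
      have := Finset.single_le_sum (f := fun r => C r * a r) (fun r _ => hCa r)
        (Finset.mem_range.2 (Nat.lt_succ_of_le hrℓ))
      linarith
    have h3 : C r * (D / ((n : ℝ) ^ (r - 2) * p)) ≤
        (∑ r ∈ Finset.range (ℓ + 1), C r * a r + 1) * (ε * (n / p) * n) := by
      calc C r * (D / ((n : ℝ) ^ (r - 2) * p)) ≤ C r * (a r * (ε * (n / p) * n)) :=
            mul_le_mul_of_nonneg_left h1 (hC r).le
        _ = C r * a r * (ε * (n / p) * n) := by ring
        _ ≤ _ := mul_le_mul_of_nonneg_right h2 (by positivity)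
    have h4 : 0 ≤ 10 ^ 6 * (ℓ : ℝ) ^ 3 * (3 * (r : ℝ) - 4) ^ 3 * ε * n := by
      have : 0 ≤ 3 * (r : ℝ) - 4 := by linarith
      positivity
    linarith
  · intro r hr hrℓ f hf
    refine ⟨fun n => C r * |f n / (n : ℝ) ^ ((r : ℝ) - 1 + 1 / (ℓ : ℝ))|, ?_, ?_⟩
    · simpa using (hf.tendsto_div_nhds_zero.abs).const_mul (C r)
    · filter_upwards [eventually_gt_atTop ℓ] with n hn H hH hcard
      obtain ⟨hle, m, hm, hcontains⟩ := hcore r hr hrℓ n hn H hH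
      refine ⟨m, le_trans ?_ hm, hcontains⟩
      have hn0 : (0 : ℝ) < n := by exact_mod_cast (by omega : 0 < n)
      set p : ℝ := (n : ℝ) ^ (1 / (ℓ : ℝ)) with hp
      have hp0 : 0 < p := Real.rpow_pos_of_pos hn0 _
      have hpow : (n : ℝ) ^ ((r : ℝ) - 1 + 1 / (ℓ : ℝ)) = (n : ℝ) ^ (r - 2) * n * p := by
        rw [Real.rpow_add hn0, ← pow_succ, ← Real.rpow_natCast]
        congr 2
        rw [show r - 2 + 1 = r - 1 by omega, Nat.cast_sub (by omega), Nat.cast_one]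
      have h1 : ((RGraph.turanNumber r n ℓ : ℝ) - H.edges.card) / ((n : ℝ) ^ (r - 2) * p) ≤
          |f n / (n : ℝ) ^ ((r : ℝ) - 1 + 1 / (ℓ : ℝ))| * n := by
        rw [hpow, abs_div, abs_of_pos (by positivity : (0 : ℝ) < (n : ℝ) ^ (r - 2) * n * p),
          div_mul_eq_mul_div, div_le_div_iff₀ (by positivity) (by positivity)]
        have h2 : (RGraph.turanNumber r n ℓ : ℝ) - H.edges.card ≤ |f n| := by
          linarith [le_abs_self (f n)]
        calc ((RGraph.turanNumber r n ℓ : ℝ) - H.edges.card) * ((n : ℝ) ^ (r - 2) * n * p)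
            ≤ |f n| * ((n : ℝ) ^ (r - 2) * n * p) := by gcongr
          _ = |f n| * n * ((n : ℝ) ^ (r - 2) * p) := by ring
      have h2 := mul_le_mul_of_nonneg_left h1 (hC r).le
      linarith
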